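/- Let $d\ge 1$, let $\|\cdot\|$ be the Euclidean norm on $\mathbb R^d$ and $\mathbb S^{d-1}=\{x\in\mathbb R^d:\|x\|=1\}$; elements of $\mathbb S^{d-1}$ are called directions. A convex body is a compact convex subset of $\mathbb R^d$ with nonempty interior. For a convex body $G$ let $L^p(G)$ be the Lebesgue space with its usual (quasi-)norm if $0<p<\infty$, and let $L^\infty(G)=C(G)$ with the uniform norm. On subsets $S\subseteq G$, $\|\cdot\|_{L^p(S)}$ is $(\int_S|\cdot|^p)^{1/p}$ for $p<\infty$ and $\sup_S|\cdot|$ for $p=\infty$. For $r\in\mathbb N=\{1,2,\dots\}$, $0<p\le\infty$, a set of directions $\mathcal E\subseteq\mathbb S^{d-1}$ and $f\in L^p(G)$ put $$\Delta_h^r f(x)=\sum_{j=0}^r(-1)^{r+j}\binom rj f(x+jh),\qquad G_{r,h}=\{x: x,x+h,\dots,x+rh\in G\},$$ $$\omega^r_{\mathcal E}(f;G)_p=\sup_{\xi\in\mathcal E}\ \sup_{|u|\le \operatorname{diam}(G)}\|\Delta^r_{u\xi}f\|_{L^p(G_{r,u\xi})}.$$ Let $\Pi^d_{r-1}(\mathcal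 E)$ be the space of all continuous $Q:\mathbb R^d\to\mathbb R$ such that for all $x\in\mathbb R^d$ and $\xi\in\mathcal E$ the function $t\mapsto Q(x+t\xi)$ is an algebraic polynomial of degree $<r$, let $E_r(f;\mathcal E)_{L^p(G)}=\inf\{\|f-Q\|_{L^p(G)}:Q\in\Pi^d_{r-1}(\mathcal E)\}$, and define the directional Whitney constant $$w_r(G;\mathcal E)_p=\sup\{E_r(f;\mathcal E)_{L^p(G)}:\ f\in L^p(G),\ \omega^r_{\mathcal E}(f;G)_p\le 1\}\in[0,\infty].$$ A set of directions $\mathcal D$ illuminates $G$ if for every boundary point $x$ of $G$ there is $e\in\mathcal D$ such that the ray $\{x+te:t\ge 0\}$ meets the interior of $G$. The convex body $G$ is X-rayed by $\mathcal E$ if $\mathcal E\cup(-\mathcal E)$ illuminates $G$. Let $X_d(G)$ be the smallest $n$ for which $G$ is X-rayed by some set of $n$ directions, and let $\mathcal N_d(G)$ be the smallest $n$ for which there is a set $\mathcal E$ of $n$ directions with $\operatorname{span}(\mathcal E)=\mathbb R^d$ and $w_r(G;\mathcal E)_p<\infty$ for all $r\in\mathbb N$ and $0<p\le\infty$. **Theorem.**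 Let $G\subset\mathbb R^d$ be a convex body. If $G$ is X-rayed by a finite set $\mathcal E\subset\mathbb S^{d-1}$ of directions, then $$w_r(G;\mathcal E)_p<\infty\qquad\text{for all } r\in\mathbb N \text{ and } 0<p\le\infty .$$ Moreover, $G$ is X-rayed by some finite set of directions, and consequently $$\mathcal N_d(G)\le X_d(G)<\infty .$$ -/

import Mathlib

open MeasureTheory Set
open scoped ENNReal Pointwise

noncomputable section

namespace DirWhitney

/-- The Euclidean space `ℝ^d`, with its Euclidean norm and Lebesgue measure `volume`. -/
abbrev Space (d : ℕ) : Type := EuclideanSpace ℝ (Fin d)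

variable {d : ℕ}

/-! ### Function spaces and norms -/

/-- Membership in `L^p(Ω)`: the Lebesgue space for `0 < p < ∞`, and `C(closure Ω)` for `p = ∞`. -/
def MemLpOn (p : ℝ≥0∞) (Ω : Set (Space d)) (f : Space d → ℝ) : Prop :=
  (p ≠ ∞ → MemLp f p (volume.restrict Ω)) ∧ (p = ∞ → ContinuousOn f (closure Ω))

open Classical in
/-- The `L^p(S)` (quasi-)norm: `(∫_S |f|^p)^(1/p)` for `0 < p < ∞`, and the uniform norm
`sup_S |f|` (a true supremum, not an essential one) for `p = ∞`. -/
def normOn (p : ℝ≥0∞) (S : Set (Space d)) (f : Space d → ℝ) : ℝ≥0∞ :=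
  if p = ∞ then ⨆ x ∈ S, ‖f x‖ₑ else eLpNorm f p (volume.restrict S)

/-! ### Directional moduli of smoothness -/

/-- `Ω_{r,h}`: the points `x` with `x, x + h, …, x + r h ∈ Ω`. -/
def diffDomain (r : ℕ) (h : Space d) (Ω : Set (Space d)) : Set (Space d) :=
  {x | ∀ j : ℕ, j ≤ r → x + (j : ℝ) • h ∈ Ω}

/-- The `r`-th order difference
`Δ_h^r f (x) = ∑_{j=0}^r (-1)^(r+j) (r choose j) f (x + j h)`. -/
def diff (r : ℕ) (h : Space d) (f : Space d → ℝ) (x : Space d) : ℝ :=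
  ∑ j ∈ Finset.range (r + 1), (-1 : ℝ) ^ (r + j) * (r.choose j : ℝ) * f (x + (j : ℝ) • h)

/-- `ω_ξ^r(f, t)_{L^p(Ω)}`. -/
def modulusAlong (r : ℕ) (p : ℝ≥0∞) (Ω : Set (Space d)) (ξ : Space d) (f : Space d → ℝ)
    (t : ℝ) : ℝ≥0∞ :=
  ⨆ (u : ℝ) (_ : |u| ≤ t), normOn p (diffDomain r (u • ξ) Ω) (diff r (u • ξ) f)

/-- `ω_E^r(f; Ω)_p`: the supremum over `ξ ∈ E` of `ω_ξ^r(f, diam Ω)_{L^p(Ω)}`. -/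
def modulus (r : ℕ) (p : ℝ≥0∞) (Ω : Set (Space d)) (E : Set (Space d)) (f : Space d → ℝ) :
    ℝ≥0∞ :=
  ⨆ ξ ∈ E, modulusAlong r p Ω ξ f (Metric.diam Ω)

/-! ### Best approximation and the directional Whitney constant -/

/-- `Π_{r-1}^d(E)`: the continuous functions on `ℝ^d` whose restriction to each line with
direction in `E` is a polynomial of degree `< r`. -/
def polySpace (r : ℕ) (E : Set (Space d)) : Set (Space d → ℝ) :=
  {Q | Continuous Q ∧ ∀ x : Space d, ∀ ξ ∈ E, ∃ g : Polynomial ℝ,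
    g.degree < (r : WithBot ℕ) ∧ ∀ t : ℝ, Q (x + t • ξ) = g.eval t}

/-- `E_r(f; E)_{L^p(Ω)}`: the distance in `L^p(Ω)` from `f` to `Π_{r-1}^d(E)`. -/
def bestApprox (r : ℕ) (p : ℝ≥0∞) (Ω : Set (Space d)) (E : Set (Space d))
    (f : Space d → ℝ) : ℝ≥0∞ :=
  ⨅ Q ∈ polySpace r E, normOn p Ω (fun x => f x - Q x)

/-- The directional Whitney constant `w_r(Ω; E)_p`, with values in `[0, ∞]`. -/
def whitneyConst (r : ℕ) (p : ℝ≥0∞) (Ω : Set (Space d)) (E : Set (Space d)) : ℝ≥0∞ :=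
  ⨆ (f : Space d → ℝ) (_ : MemLpOn p Ω f) (_ : modulus r p Ω E f ≤ 1), bestApprox r p Ω E f

/-! ### Convex bodies, illumination and X-rays -/

/-- A convex body: a compact convex set with nonempty interior. -/
structure IsConvexBody (G : Set (Space d)) : Prop where
  isCompact : IsCompact G
  convex : Convex ℝ G
  interior_nonempty : (interior G).Nonempty

/-- The boundary point `x` of `G` is illuminated in the direction `e`: the ray
`{x + t e : t ≥ 0}` meets the interior of `G`. -/
def IsIlluminatedAt (G : Set (Space d)) (x e : Space d) : Prop :=
  ∃ t : ℝ, 0 ≤ t ∧ x + t • e ∈ interior G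

/-- `E` illuminates `G`. -/
def Illuminates (E G : Set (Space d)) : Prop :=
  ∀ x ∈ frontier G, ∃ e ∈ E, IsIlluminatedAt G x e

/-- `G` is X-rayed by `E`. -/
def XRays (E G : Set (Space d)) : Prop :=
  Illuminates (E ∪ -E) G

/-- `X_d(G)`: the least size of a finite set of directions that X-rays `G`
(the value is `⊤` if there is none). -/
def xrayNumber (G : Set (Space d)) : ℕ∞ :=
  sInf {n : ℕ∞ | ∃ E : Finset (Space d), (E : Set (Space d)) ⊆ Metric.sphere 0 1 ∧
    (E.card : ℕ∞) = n ∧ XRays (E : Set (Space d)) G}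

/-- `N_d(G)`: the least size of a finite set `E` of directions that spans `ℝ^d` and
satisfies `w_r(G; E)_p < ∞` for all `r ≥ 1` and `0 < p ≤ ∞` (the value is `⊤` if there is none). -/
def whitneyNumber (G : Set (Space d)) : ℕ∞ :=
  sInf {n : ℕ∞ | ∃ E : Finset (Space d), (E : Set (Space d)) ⊆ Metric.sphere 0 1 ∧
    (E.card : ℕ∞) = n ∧ Submodule.span ℝ (E : Set (Space d)) = ⊤ ∧
    ∀ r : ℕ, 1 ≤ r → ∀ p : ℝ≥0∞, 0 < p → whitneyConst r p G (E : Set (Space d)) < ∞}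

end DirWhitney

end

/-!
The proof works with the power `fNorm p S f = ‖f‖_{L^p(S)} ^ min (1, p)`, which is subadditive and
translation invariant for every `0 < p ≤ ∞`; all exponents are treated at once.

*Whitney's inequality on a small box* (`exists_tpoly_approx`). Directions that X-ray `G` span the
space, so there is a box `K` inside `G` whose edges are parallel to directions of `E`. A Marchaud
type inequality (`dyadicBound_zero`, `first_diff_box`) shows that a function `g` with bounded differences
of order `r` along the edges has first differences of size at most `C + θ ‖g‖` along all short
vectors, with `θ` as small as desired. Averaging over the position of a fine grid
(`exists_sampling`), one finds sampled values of `g` that reproduce `g` up to such an error and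
whose grid differences of order `r` are bounded. These values therefore agree, up to a bounded error, with
their tensor product interpolation polynomial at a corner of the grid
(`exists_tpoly_interpolating`, `abs_le_of_grid_diff`). Applied to `g = f - q` with `q` a nearly best
approximation of `f`, the small multiples of `‖g‖` can be absorbed, and the error of best
approximation is bounded.

*Correction of the polynomial* (`exists_polySpace_approx`). The set `E` may have more directions
than the box has edges. The differences of the approximating polynomial along them are bounded, and
a polynomial for which they vanish belongs to `polySpace r E`; since the space of polynomials is
finite-dimensional, the distance to `polySpace r E` is bounded (`exists_kernel_approx`).

*Propagation* (`controls_of_xRays`). If `f - Q` is under control near `x + h, …, x + r h`, with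
`h` parallel to a direction of `E`, then the bounded difference of order `r` with step `h` puts it
under control near `x`. Since `E` spans, this leads from the box to the whole interior of `G`. If a
boundary point `x` is illuminated by a direction of `E ∪ -E`, the points `x + h, …, x + r h` can be
taken in the interior; this is where the X-ray hypothesis enters. Compactness of `G` concludes.

A convex body is X-rayed by finitely many directions by compactness of its boundary, and X-raying
sets span (`exists_finset_xRays`, `span_eq_top_of_xRays`), which gives the inequality between the
two numbers.
-/

open scoped Topology

namespace DirWhitney

variable {d : ℕ} {p : ℝ≥0∞}

section

/-! ### The subadditive power of the quasi-norm -/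

/-- The exponent `min (1, p)`, for which the power of the `L^p` quasi-norm is subadditive. -/
noncomputable def fExp (p : ℝ≥0∞) : ℝ := (min 1 p).toReal

/-- The `F`-norm `‖f‖_{L^p(S)} ^ min (1, p)`: subadditive for every `p > 0`, at the price of
being homogeneous of degree `min (1, p)` only. -/
noncomputable def fNorm (p : ℝ≥0∞) (S : Set (Space d)) (f : Space d → ℝ) : ℝ≥0∞ :=
  normOn p S f ^ fExp p

/-- The measurability needed for the triangle inequality: none for the uniform norm. -/
def Adm (p : ℝ≥0∞) (f : Space d → ℝ) : Prop := p ≠ ∞ → Measurable f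

variable {S T : Set (Space d)} {f g : Space d → ℝ}

theorem fExp_pos (hp : 0 < p) : 0 < fExp p :=
  ENNReal.toReal_pos (by simp [hp.ne']) (ne_of_lt (lt_of_le_of_lt (min_le_left _ _) (by simp)))

theorem fExp_nonneg (p : ℝ≥0∞) : 0 ≤ fExp p := ENNReal.toReal_nonneg

theorem Adm.sub (hf : Adm p f) (hg : Adm p g) : Adm p (fun x => f x - g x) :=
  fun h => (hf h).sub (hg h)

theorem Adm.add (hf : Adm p f) (hg : Adm p g) : Adm p (fun x => f x + g x) :=
  fun h => (hf h).add (hg h)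

theorem Adm.const_mul (c : ℝ) (hf : Adm p f) : Adm p (fun x => c * f x) :=
  fun h => (hf h).const_mul c

theorem Adm.comp (hf : Adm p f) {k : Space d → Space d} (hk : Measurable k) :
    Adm p (fun x => f (k x)) :=
  fun h => (hf h).comp hk

theorem Adm.shift (hf : Adm p f) (h : Space d) : Adm p (fun x => f (x + h)) :=
  hf.comp (measurable_add_const h)

theorem Adm.sum {ι : Type*} (s : Finset ι) {F : ι → Space d → ℝ} (hF : ∀ i ∈ s, Adm p (F i)) :
    Adm p (fun x => ∑ i ∈ s, F i x) :=
  fun h => Finset.measurable_fun_sum s fun i hi => hF i hi h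

theorem Adm.of_continuous (hf : Continuous f) : Adm p f := fun _ => hf.measurable

theorem normOn_top (S : Set (Space d)) (f : Space d → ℝ) :
    normOn ∞ S f = ⨆ x ∈ S, ‖f x‖ₑ := by simp [normOn]

theorem normOn_of_ne_top (hp : p ≠ ∞) (S : Set (Space d)) (f : Space d → ℝ) :
    normOn p S f = eLpNorm f p (volume.restrict S) := by simp [normOn, hp]

theorem fExp_top : fExp ∞ = 1 := by simp [fExp]

theorem fNorm_top (S : Set (Space d)) (f : Space d → ℝ) :
    fNorm ∞ S f = ⨆ x ∈ S, ‖f x‖ₑ := by simp [fNorm, fExp_top, normOn_top]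

theorem fNorm_of_ne_top (hp0 : 0 < p) (hp : p ≠ ∞) (S : Set (Space d)) (f : Space d → ℝ) :
    fNorm p S f = (∫⁻ x in S, ‖f x‖ₑ ^ p.toReal) ^ (fExp p / p.toReal) := by
  rw [fNorm, normOn_of_ne_top hp, eLpNorm_eq_lintegral_rpow_enorm_toReal hp0.ne' hp,
    ← ENNReal.rpow_mul]
  congr 1; ring

theorem fNorm_mono (h : S ⊆ T) (f : Space d → ℝ) : fNorm p S f ≤ fNorm p T f := by
  refine ENNReal.rpow_le_rpow ?_ (fExp_nonneg p)
  by_cases hp : p = ∞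
  · subst hp
    simp only [normOn_top]
    exact biSup_mono fun x hx => h hx
  · simp only [normOn_of_ne_top hp]
    exact eLpNorm_mono_measure _ (Measure.restrict_mono h le_rfl)

theorem normOn_mono_fun (hS : MeasurableSet S) (h : ∀ x ∈ S, ‖f x‖ₑ ≤ ‖g x‖ₑ) :
    normOn p S f ≤ normOn p S g := by
  by_cases hp : p = ∞
  · subst hp
    simp only [normOn_top]
    exact iSup₂_mono h
  · simp only [normOn_of_ne_top hp]
    exact eLpNorm_mono_enorm_ae ((ae_restrict_iff' hS).2 (ae_of_all _ h))

theorem fNorm_mono_fun (hS : MeasurableSet S) (h : ∀ x ∈ S, ‖f x‖ₑ ≤ ‖g x‖ₑ) :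
    fNorm p S f ≤ fNorm p S g :=
  ENNReal.rpow_le_rpow (normOn_mono_fun hS h) (fExp_nonneg p)

theorem fNorm_const_mul (c : ℝ) (f : Space d → ℝ) :
    fNorm p S (fun x => c * f x) = ‖c‖ₑ ^ fExp p * fNorm p S f := by
  rw [fNorm, fNorm, ← ENNReal.mul_rpow_of_nonneg _ _ (fExp_nonneg p)]
  congr 1
  by_cases hp : p = ∞
  · subst hp
    simp only [normOn_top, enorm_mul, ENNReal.mul_iSup]
  · simp only [normOn_of_ne_top hp]
    exact eLpNorm_const_smul c f p _

theorem fNorm_neg (f : Space d → ℝ) : fNorm p S (fun x => -f x) = fNorm p S f := by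
  have := fNorm_const_mul (p := p) (S := S) (-1) f
  simpa using this

theorem fNorm_shift_le (h : Space d) (hST : ∀ x ∈ S, x + h ∈ T) (f : Space d → ℝ) :
    fNorm p S (fun x => f (x + h)) ≤ fNorm p T f := by
  refine ENNReal.rpow_le_rpow ?_ (fExp_nonneg p)
  by_cases hp : p = ∞
  · subst hp
    simp only [normOn_top]
    exact iSup₂_le fun x hx => le_iSup₂_of_le (x + h) (hST x hx) le_rfl
  · simp only [normOn_of_ne_top hp]
    have hm : MeasurePreserving (fun x : Space d => x + h) volume volume :=
      measurePreserving_add_right volume h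
    have he : MeasurableEmbedding (fun x : Space d => x + h) := measurableEmbedding_addRight h
    calc eLpNorm (fun x => f (x + h)) p (volume.restrict S)
        ≤ eLpNorm (fun x => f (x + h)) p (volume.restrict ((fun x : Space d => x + h) ⁻¹' T)) :=
          eLpNorm_mono_measure _ (Measure.restrict_mono hST le_rfl)
      _ = eLpNorm f p (volume.restrict T) := by
          have h2 := (hm.restrict_preimage_emb he T).map_eq
          rw [← h2, he.eLpNorm_map_measure]
          rfl

theorem fNorm_add_le (hp0 : 0 < p) (hf : Adm p f) (hg : Adm p g) :
    fNorm p S (fun x => f x + g x) ≤ fNorm p S f + fNorm p S g := by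
  by_cases hp : p = ∞
  · subst hp
    simp only [fNorm_top]
    refine iSup₂_le fun x hx => (enorm_add_le _ _).trans (add_le_add ?_ ?_)
    · exact le_iSup₂_of_le x hx le_rfl
    · exact le_iSup₂_of_le x hx le_rfl
  · rcases le_total 1 p with h1 | h1
    · have : fExp p = 1 := by simp [fExp, h1]
      simp only [fNorm, this, ENNReal.rpow_one, normOn_of_ne_top hp]
      exact eLpNorm_add_le (hf hp).aestronglyMeasurable (hg hp).aestronglyMeasurable h1
    · have hP : 0 < p.toReal := ENNReal.toReal_pos hp0.ne' hp
      have hP1 : p.toReal ≤ 1 := by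
        simpa using ENNReal.toReal_mono ENNReal.one_ne_top h1
      have : fExp p = p.toReal := by simp [fExp, h1]
      simp only [fNorm_of_ne_top hp0 hp, this, div_self hP.ne', ENNReal.rpow_one]
      rw [← lintegral_add_left ((hf hp).enorm.pow_const _)]
      refine lintegral_mono fun x => ?_
      exact (ENNReal.rpow_le_rpow (enorm_add_le _ _) hP.le).trans
        (ENNReal.rpow_add_le_add_rpow _ _ hP.le hP1)

theorem fNorm_sub_le (hp0 : 0 < p) (hf : Adm p f) (hg : Adm p g) :
    fNorm p S (fun x => f x - g x) ≤ fNorm p S f + fNorm p S g := by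
  have := fNorm_add_le (S := S) hp0 hf (hg.const_mul (-1))
  simp only [neg_one_mul, fNorm_neg, ← sub_eq_add_neg] at this
  exact this

theorem fNorm_zero (hp0 : 0 < p) : fNorm p S (fun _ => 0) = 0 := by
  have := fNorm_const_mul (p := p) (S := S) 0 (fun _ => 0)
  simpa [ENNReal.zero_rpow_of_pos (fExp_pos hp0)] using this

theorem fNorm_sum_le (hp0 : 0 < p) {ι : Type*} (s : Finset ι) {F : ι → Space d → ℝ}
    (hF : ∀ i ∈ s, Adm p (F i)) :
    fNorm p S (fun x => ∑ i ∈ s, F i x) ≤ ∑ i ∈ s, fNorm p S (F i) := by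
  classical
  induction s using Finset.induction_on with
  | empty => simp [fNorm_zero hp0]
  | insert a s ha ih =>
    simp only [Finset.sum_insert ha]
    refine (fNorm_add_le hp0 (hF a (by simp)) (Adm.sum s fun i hi => hF i (by simp [hi]))).trans ?_
    gcongr
    exact ih fun i hi => hF i (by simp [hi])

theorem fNorm_union_le (hp0 : 0 < p) (S T : Set (Space d)) (f : Space d → ℝ) :
    fNorm p (S ∪ T) f ≤ fNorm p S f + fNorm p T f := by
  by_cases hp : p = ∞
  · subst hp
    simp only [fNorm_top, iSup_union]
    exact max_le le_self_add le_add_self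
  · have hP : 0 < p.toReal := ENNReal.toReal_pos hp0.ne' hp
    simp only [fNorm_of_ne_top hp0 hp]
    have h1 : fExp p / p.toReal ≤ 1 := by
      rw [div_le_one hP]
      exact ENNReal.toReal_mono hp (min_le_right _ _)
    have h0 : 0 ≤ fExp p / p.toReal := div_nonneg (fExp_nonneg p) hP.le
    refine (ENNReal.rpow_le_rpow (lintegral_union_le _ S T) h0).trans ?_
    exact ENNReal.rpow_add_le_add_rpow _ _ h0 h1

theorem fNorm_one_lt_top (hS : volume S ≠ ∞) : fNorm p S (fun _ => (1 : ℝ)) < ∞ := by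
  refine ENNReal.rpow_lt_top_of_nonneg (fExp_nonneg p) (ne_of_lt ?_)
  by_cases hp : p = ∞
  · subst hp
    rw [normOn_top]
    exact lt_of_le_of_lt (iSup₂_le fun x _ => le_rfl) (by simp : ‖(1 : ℝ)‖ₑ < ∞)
  · rw [normOn_of_ne_top hp]
    have : IsFiniteMeasure (volume.restrict S) := ⟨by simpa using hS.lt_top⟩
    exact (memLp_const (1 : ℝ)).2

theorem fNorm_le_of_bound (hS : MeasurableSet S) {c : ℝ} (hc : 0 ≤ c) (h : ∀ x ∈ S, |f x| ≤ c) :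
    fNorm p S f ≤ ENNReal.ofReal c ^ fExp p * fNorm p S (fun _ => (1 : ℝ)) := by
  have h1 := fNorm_const_mul (p := p) (S := S) c (fun _ => 1)
  rw [Real.enorm_of_nonneg hc] at h1
  rw [← h1]
  refine fNorm_mono_fun hS fun x hx => ?_
  rw [Real.enorm_eq_ofReal_abs, Real.enorm_eq_ofReal_abs]
  refine ENNReal.ofReal_le_ofReal ?_
  simpa [abs_of_nonneg hc] using h x hx

/-- A continuous function with vanishing `F`-norm on an open set vanishes there. -/
theorem eqOn_zero_of_fNorm_eq_zero (hp0 : 0 < p) (hS : IsOpen S) (hf : Continuous f)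
    (h : fNorm p S f = 0) : ∀ x ∈ S, f x = 0 := by
  have h' : normOn p S f = 0 := by
    rcases ENNReal.rpow_eq_zero_iff.1 h with h | h
    · exact h.1
    · exact absurd h.2 (not_lt.2 (fExp_nonneg p))
  by_cases hp : p = ∞
  · subst hp
    rw [normOn_top] at h'
    intro x hx
    simpa using (ENNReal.iSup_eq_zero.1 (ENNReal.iSup_eq_zero.1 h' x)) hx
  · rw [normOn_of_ne_top hp,
      eLpNorm_eq_zero_iff hf.aestronglyMeasurable hp0.ne'] at h'
    exact Measure.eqOn_open_of_ae_eq h' hS hf.continuousOn continuousOn_const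

/-! ### Polynomials in a translation -/

open Polynomial in
/-- The operator `F(τ_h)`, where `τ_h` is the translation `f ↦ f (· + h)`. -/
noncomputable def shiftPoly (h : Space d) (F : ℝ[X]) (f : Space d → ℝ) : Space d → ℝ :=
  aeval (LinearMap.funLeft ℝ ℝ (fun x : Space d => x + h)) F f

open Polynomial

theorem funLeft_pow_apply (h : Space d) (n : ℕ) (f : Space d → ℝ) (x : Space d) :
    ((LinearMap.funLeft ℝ ℝ (fun x : Space d => x + h)) ^ n) f x = f (x + (n : ℝ) • h) := by
  induction n generalizing x with
  | zero => simp
  | succ n ih =>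
    rw [pow_succ', Module.End.mul_apply, LinearMap.funLeft_apply, ih]
    congr 1
    push_cast
    module

theorem shiftPoly_apply (h : Space d) (F : ℝ[X]) (f : Space d → ℝ) (x : Space d) :
    shiftPoly h F f x = ∑ j ∈ Finset.range (F.natDegree + 1), F.coeff j * f (x + (j : ℝ) • h) := by
  simp [shiftPoly, aeval_eq_sum_range, LinearMap.sum_apply, Finset.sum_apply,
    funLeft_pow_apply]

theorem shiftPoly_mul (h : Space d) (F F' : ℝ[X]) (f : Space d → ℝ) :
    shiftPoly h (F * F') f = shiftPoly h F (shiftPoly h F' f) := by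
  simp [shiftPoly]

theorem shiftPoly_sub (h : Space d) (F F' : ℝ[X]) (f : Space d → ℝ) (x : Space d) :
    shiftPoly h (F - F') f x = shiftPoly h F f x - shiftPoly h F' f x := by
  simp [shiftPoly]

theorem shiftPoly_C_mul (h : Space d) (c : ℝ) (F : ℝ[X]) (f : Space d → ℝ) (x : Space d) :
    shiftPoly h (C c * F) f x = c * shiftPoly h F f x := by
  simp [shiftPoly]

theorem shiftPoly_expand (h : Space d) (F : ℝ[X]) (f : Space d → ℝ) :
    shiftPoly h (expand ℝ 2 F) f = shiftPoly ((2 : ℝ) • h) F f := by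
  have : (LinearMap.funLeft ℝ ℝ (fun x : Space d => x + h)) ^ 2
      = LinearMap.funLeft ℝ ℝ (fun x : Space d => x + (2 : ℝ) • h) := by
    ext f x
    rw [funLeft_pow_apply]
    simp [LinearMap.funLeft_apply]
  rw [shiftPoly, expand_aeval, this, shiftPoly]

theorem shiftPoly_X_sub_one (h : Space d) (f : Space d → ℝ) (x : Space d) :
    shiftPoly h (X - 1) f x = f (x + h) - f x := by
  simp [shiftPoly, LinearMap.funLeft_apply]

theorem neg_one_pow_add_eq_sub {r j : ℕ} (hj : j ≤ r) : (-1 : ℝ) ^ (r + j) = (-1) ^ (r - j) := by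
  obtain ⟨k, rfl⟩ := Nat.exists_eq_add_of_le hj
  rw [Nat.add_sub_cancel_left, show j + k + j = 2 * j + k by ring, pow_add, pow_mul]
  simp

theorem shiftPoly_X_sub_one_pow (r : ℕ) (h : Space d) (f : Space d → ℝ) :
    shiftPoly h ((X - 1) ^ r) f = diff r h f := by
  funext x
  have h1 : ((X : ℝ[X]) - 1) ^ r = ∑ m ∈ Finset.range (r + 1),
      X ^ m * C ((-1 : ℝ) ^ (r + m) * (r.choose m : ℝ)) := by
    rw [sub_eq_add_neg, add_pow]
    refine Finset.sum_congr rfl fun m hm => ?_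
    have hm' : m ≤ r := Nat.lt_succ_iff.1 (Finset.mem_range.1 hm)
    rw [neg_one_pow_add_eq_sub hm']
    simp [mul_assoc]
  rw [shiftPoly, h1, diff]
  rw [map_sum, LinearMap.sum_apply, Finset.sum_apply]
  refine Finset.sum_congr rfl fun m _ => ?_
  rw [map_mul, map_pow, aeval_X, aeval_C, Module.End.mul_apply, funLeft_pow_apply,
    Module.algebraMap_end_apply, Pi.smul_apply, smul_eq_mul]

theorem Adm.shiftPoly (hf : Adm p f) (h : Space d) (F : ℝ[X]) :
    Adm p (DirWhitney.shiftPoly h F f) := by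
  have : DirWhitney.shiftPoly h F f = fun x => ∑ j ∈ Finset.range (F.natDegree + 1),
      F.coeff j * f (x + (j : ℝ) • h) := funext fun x => shiftPoly_apply h F f x
  rw [this]
  exact Adm.sum _ fun j _ => (hf.shift _).const_mul _

theorem Adm.diff (hf : Adm p f) (r : ℕ) (h : Space d) : Adm p (DirWhitney.diff r h f) := by
  rw [← shiftPoly_X_sub_one_pow]
  exact hf.shiftPoly h _

/-- A bound for the norm of `F(τ_h)` as an operator on `L^p`. -/
noncomputable def polyBound (p : ℝ≥0∞) (F : ℝ[X]) : ℝ≥0∞ :=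
  ∑ j ∈ Finset.range (F.natDegree + 1), ‖F.coeff j‖ₑ ^ fExp p

theorem polyBound_lt_top (p : ℝ≥0∞) (F : ℝ[X]) : polyBound p F < ∞ :=
  ENNReal.sum_lt_top.2 fun _ _ => ENNReal.rpow_lt_top_of_nonneg (fExp_nonneg p) (by simp)

theorem fNorm_shiftPoly_le (hp0 : 0 < p) (hf : Adm p f) (h : Space d) (F : ℝ[X])
    (hST : ∀ x ∈ S, ∀ j : ℕ, j ≤ F.natDegree → x + (j : ℝ) • h ∈ T) :
    fNorm p S (shiftPoly h F f) ≤ polyBound p F * fNorm p T f := by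
  have : shiftPoly h F f = fun x => ∑ j ∈ Finset.range (F.natDegree + 1),
      F.coeff j * f (x + (j : ℝ) • h) := funext fun x => shiftPoly_apply h F f x
  rw [this, polyBound, Finset.sum_mul]
  refine (fNorm_sum_le hp0 _ fun j _ => (hf.shift _).const_mul _).trans ?_
  refine Finset.sum_le_sum fun j hj => ?_
  rw [fNorm_const_mul]
  gcongr
  exact fNorm_shift_le _ (fun x hx => hST x hx j (Nat.lt_succ_iff.1 (Finset.mem_range.1 hj))) f

end

section

open Polynomial

/-! ### First differences are controlled by differences of order `r` -/

/-- The polynomials with `F₀ = X - 1` and `F_{n+1}(X) = F_n(X²) - 2^{n+1} F_n(X)`. They interpolate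
between first differences and differences of higher order: `F_n` vanishes to order `n + 1` at `1`,
while the recursion bounds `F_n(τ_h)` by half of `F_n(τ_{2h})` up to `F_{n+1}(τ_h)`. -/
noncomputable def dyadicPoly : ℕ → ℝ[X]
  | 0 => X - 1
  | n + 1 => expand ℝ 2 (dyadicPoly n) - C ((2 : ℝ) ^ (n + 1)) * dyadicPoly n

theorem X_sub_one_pow_dvd_dyadicPoly (n : ℕ) : ((X : ℝ[X]) - 1) ^ (n + 1) ∣ dyadicPoly n := by
  induction n with
  | zero => simp [dyadicPoly]
  | succ n ih =>
    obtain ⟨G, hG⟩ := ih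
    have h1 : dyadicPoly (n + 1) = (X - 1) ^ (n + 1) *
        ((X + 1) ^ (n + 1) * expand ℝ 2 G - C ((2 : ℝ) ^ (n + 1)) * G) := by
      rw [dyadicPoly, hG]
      simp only [map_mul, map_pow, map_sub, expand_X, map_one]
      rw [show (X : ℝ[X]) ^ 2 - 1 = (X - 1) * (X + 1) by ring, mul_pow]
      ring
    have h2 : (X : ℝ[X]) - 1 ∣ (X + 1) ^ (n + 1) * expand ℝ 2 G - C ((2 : ℝ) ^ (n + 1)) * G := by
      rw [← C_1, dvd_iff_isRoot, IsRoot.def]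
      simp [expand_eval]
      norm_num
    rw [h1, pow_succ]
    exact mul_dvd_mul_left _ h2

/-- One admissible configuration for the comparison of differences along `h₀`: the segments
`[x, x + h₀]` with `x ∈ S` stay in `K`, and on `K` the differences of order `r` along `h₀` are at
most `1`. -/
structure DiffSetup (r : ℕ) (p : ℝ≥0∞) (S K : Set (Space d)) (h₀ : Space d)
    (g : Space d → ℝ) : Prop where
  adm : Adm p g
  mem : ∀ x ∈ S, ∀ s : ℝ, 0 ≤ s → s ≤ 1 → x + s • h₀ ∈ K
  diff_le : ∀ u : ℝ, 0 ≤ u → ∀ T : Set (Space d),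
    (∀ x ∈ T, ∀ j : ℕ, j ≤ r → x + (j : ℝ) • (u • h₀) ∈ K) → fNorm p T (diff r (u • h₀) g) ≤ 1

/-- The estimate `‖F_n(τ_{u h₀}) g‖ ≤ C + θ ‖g‖` (in the `F`-norm) for all small `u`, uniformly
over all configurations. -/
def DyadicBound (d r : ℕ) (p : ℝ≥0∞) (n : ℕ) (θ : ℝ≥0∞) : Prop :=
  ∃ C : ℝ≥0∞, C ≠ ∞ ∧ ∃ δ : ℝ, 0 < δ ∧ ∀ (S K : Set (Space d)) (h₀ : Space d) (g : Space d → ℝ),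
    DiffSetup r p S K h₀ g → ∀ u : ℝ, 0 ≤ u → u ≤ δ →
      fNorm p S (shiftPoly (u • h₀) (dyadicPoly n) g) ≤ C + θ * fNorm p K g

theorem DyadicBound.mono {r n : ℕ} {θ θ' : ℝ≥0∞} (h : DyadicBound d r p n θ) (hθ : θ ≤ θ') :
    DyadicBound d r p n θ' := by
  obtain ⟨C, hC, δ, hδ, h⟩ := h
  refine ⟨C, hC, δ, hδ, fun S K h₀ g hs u hu hu' => (h S K h₀ g hs u hu hu').trans ?_⟩
  gcongr

theorem dyadicBound_trivial (hp0 : 0 < p) (r n : ℕ) :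
    DyadicBound d r p n (polyBound p (dyadicPoly n)) := by
  refine ⟨0, by simp, 1 / ((dyadicPoly n).natDegree + 1), by positivity,
    fun S K h₀ g hs u hu hu' => ?_⟩
  rw [zero_add]
  refine fNorm_shiftPoly_le hp0 hs.adm _ _ fun x hx j hj => ?_
  rw [smul_smul]
  refine hs.mem x hx _ (by positivity) ?_
  have : (j : ℝ) ≤ (dyadicPoly n).natDegree := by exact_mod_cast hj
  rw [le_div_iff₀ (by positivity)] at hu'
  nlinarith

/-- At level `r - 1` the polynomial is divisible by `(X - 1)^r`, so only the differences of order
`r` enter. -/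
theorem dyadicBound_top (hp0 : 0 < p) {r : ℕ} (hr : 1 ≤ r) :
    DyadicBound d r p (r - 1) 0 := by
  obtain ⟨G, hG⟩ := X_sub_one_pow_dvd_dyadicPoly (r - 1)
  rw [Nat.sub_add_cancel hr, mul_comm] at hG
  refine ⟨polyBound p G, (polyBound_lt_top p G).ne, 1 / (G.natDegree + r), by positivity,
    fun S K h₀ g hs u hu hu' => ?_⟩
  rw [hG, shiftPoly_mul, shiftPoly_X_sub_one_pow, zero_mul, add_zero]
  refine (fNorm_shiftPoly_le (T := {x | ∀ j : ℕ, j ≤ r → x + (j : ℝ) • (u • h₀) ∈ K}) hp0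
    (hs.adm.diff r _) _ _ fun x hx i hi j hj => ?_).trans ?_
  · have h1 : (i : ℝ) ≤ G.natDegree := by exact_mod_cast hi
    have h2 : (j : ℝ) ≤ r := by exact_mod_cast hj
    rw [le_div_iff₀ (by positivity)] at hu'
    have := hs.mem x hx (i * u + j * u) (by positivity) (by nlinarith)
    convert this using 1
    module
  · exact mul_le_of_le_one_right' (hs.diff_le u hu _ fun x hx => hx)

theorem DyadicBound.step (hp0 : 0 < p) {r n : ℕ} {θ θ' : ℝ≥0∞} (h : DyadicBound d r p n θ)
    (h' : DyadicBound d r p (n + 1) θ') :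
    DyadicBound d r p n (‖(1 / 2 : ℝ)‖ₑ ^ fExp p * (θ + θ')) := by
  obtain ⟨C, hC, δ, hδ, h⟩ := h
  obtain ⟨C', hC', δ', hδ', h'⟩ := h'
  refine ⟨‖(1 / 2 : ℝ)‖ₑ ^ fExp p * (C + C'), ENNReal.mul_ne_top
    (ENNReal.rpow_ne_top_of_nonneg (fExp_nonneg p) (by simp)) (by simp [hC, hC']),
    min (δ / 2) δ', by positivity, fun S K h₀ g hs u hu hu' => ?_⟩
  have e1 : shiftPoly (u • h₀) (dyadicPoly n) g = fun x => ((2 : ℝ) ^ (n + 1))⁻¹ *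
      (shiftPoly ((2 * u) • h₀) (dyadicPoly n) g x
        - shiftPoly (u • h₀) (dyadicPoly (n + 1)) g x) := by
    funext x
    rw [dyadicPoly, shiftPoly_sub, shiftPoly_expand, shiftPoly_C_mul, smul_smul]
    field_simp
    ring
  rw [e1, fNorm_const_mul]
  have e2 : ‖((2 : ℝ) ^ (n + 1))⁻¹‖ₑ ≤ ‖(1 / 2 : ℝ)‖ₑ := by
    rw [Real.enorm_of_nonneg (by positivity), Real.enorm_of_nonneg (by positivity)]
    refine ENNReal.ofReal_le_ofReal ?_
    rw [one_div]
    refine inv_anti₀ (by norm_num) ?_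
    exact le_self_pow₀ (by norm_num) (by simp)
  have e3 := fNorm_sub_le (S := S) hp0 (hs.adm.shiftPoly ((2 * u) • h₀) (dyadicPoly n))
    (hs.adm.shiftPoly (u • h₀) (dyadicPoly (n + 1)))
  have e4 := h S K h₀ g hs (2 * u) (by positivity)
    (by linarith [hu'.trans (min_le_left _ _)])
  have e5 := h' S K h₀ g hs u hu (hu'.trans (min_le_right _ _))
  calc _ ≤ ‖(1 / 2 : ℝ)‖ₑ ^ fExp p *
        ((C + θ * fNorm p K g) + (C' + θ' * fNorm p K g)) := by
        refine mul_le_mul' (ENNReal.rpow_le_rpow e2 (fExp_nonneg p)) (e3.trans ?_)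
        exact add_le_add e4 e5
    _ = _ := by ring

theorem dyadicBound_of_succ (hp0 : 0 < p) {r n : ℕ}
    (h : ∀ θ : ℝ≥0∞, 0 < θ → DyadicBound d r p (n + 1) θ) (θ : ℝ≥0∞) (hθ : 0 < θ) :
    DyadicBound d r p n θ := by
  set κ : ℝ≥0∞ := ‖(1 / 2 : ℝ)‖ₑ ^ fExp p with hκ
  have hκ1 : κ < 1 := by
    refine ENNReal.rpow_lt_one ?_ (fExp_pos hp0)
    rw [Real.enorm_of_nonneg (by positivity), ENNReal.ofReal_lt_one]
    norm_num
  set P := polyBound p (dyadicPoly n) with hP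
  have hPt : P ≠ ∞ := (polyBound_lt_top p _).ne
  wlog hθt : θ ≠ ∞ generalizing θ
  · exact (this 1 one_pos ENNReal.one_ne_top).mono (by simp [not_not.1 hθt])
  have hε : 0 < θ / 2 := ENNReal.half_pos hθ.ne'
  have key : ∀ m : ℕ, DyadicBound d r p n (κ ^ m * P + θ / 2) := by
    intro m
    induction m with
    | zero => exact (dyadicBound_trivial hp0 r n).mono (by simp [hP])
    | succ m ih =>
      have h1 := ih.step hp0 (h (θ / 2 * (1 - κ)) (ENNReal.mul_pos hε.ne' (tsub_pos_of_lt hκ1).ne'))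
      refine h1.mono ?_
      rw [← hκ]
      calc κ * (κ ^ m * P + θ / 2 + θ / 2 * (1 - κ))
          = κ ^ (m + 1) * P + (θ / 2 * κ + κ * (θ / 2 * (1 - κ))) := by ring
        _ ≤ κ ^ (m + 1) * P + (θ / 2 * κ + 1 * (θ / 2 * (1 - κ))) := by gcongr
        _ = κ ^ (m + 1) * P + θ / 2 * (κ + (1 - κ)) := by ring
        _ = κ ^ (m + 1) * P + θ / 2 := by rw [add_tsub_cancel_of_le hκ1.le, mul_one]
  have ht : Filter.Tendsto (fun m : ℕ => κ ^ m * P) Filter.atTop (nhds (0 * P)) :=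
    ENNReal.Tendsto.mul_const (ENNReal.tendsto_pow_atTop_nhds_zero_of_lt_one hκ1) (Or.inr hPt)
  rw [zero_mul] at ht
  obtain ⟨m, hm⟩ := (ht.eventually (gt_mem_nhds hε)).exists
  refine (key m).mono ?_
  calc κ ^ m * P + θ / 2 ≤ θ / 2 + θ / 2 := by gcongr
    _ = θ := ENNReal.add_halves θ

/-- A Marchaud type inequality: for small `u`, first differences along `u • h₀` are at most a
constant plus an arbitrarily small multiple of the size of the function. -/
theorem dyadicBound_zero (hp0 : 0 < p) {r : ℕ} (hr : 1 ≤ r) (θ : ℝ≥0∞) (hθ : 0 < θ) :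
    DyadicBound d r p 0 θ := by
  have : ∀ k : ℕ, k ≤ r - 1 → ∀ θ : ℝ≥0∞, 0 < θ → DyadicBound d r p (r - 1 - k) θ := by
    intro k
    induction k with
    | zero => exact fun _ θ _ => (dyadicBound_top hp0 hr).mono zero_le
    | succ k ih =>
      intro hk
      refine dyadicBound_of_succ hp0 ?_
      have := ih (by omega)
      rwa [show r - 1 - k = r - 1 - (k + 1) + 1 by omega] at this
  simpa using this (r - 1) le_rfl θ hθ

/-! ### Boxes with respect to a basis -/

/-- The half-open unit box with corner `a`, in the coordinates of the basis `b`. -/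
def box (b : Module.Basis (Fin d) ℝ (Space d)) (a : Fin d → ℝ) : Set (Space d) :=
  {x | ∀ i, a i ≤ b.repr x i ∧ b.repr x i < a i + 1}

/-- On `K`, the differences of order `r` along the vectors of `b` are at most `1`. -/
def SmallDiff (r : ℕ) (p : ℝ≥0∞) (K : Set (Space d)) (b : Module.Basis (Fin d) ℝ (Space d))
    (g : Space d → ℝ) : Prop :=
  ∀ (i : Fin d) (u : ℝ) (T : Set (Space d)),
    (∀ x ∈ T, ∀ j : ℕ, j ≤ r → x + (j : ℝ) • (u • b i) ∈ K) → fNorm p T (diff r (u • b i) g) ≤ 1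

theorem repr_add_smul (b : Module.Basis (Fin d) ℝ (Space d)) (x : Space d) (u : ℝ) (i k : Fin d) :
    b.repr (x + u • b i) k = b.repr x k + if k = i then u else 0 := by
  simp [Finsupp.single_apply, eq_comm]

theorem add_smul_mem_box {b : Module.Basis (Fin d) ℝ (Space d)} {a : Fin d → ℝ} {x : Space d}
    (hx : x ∈ box b a) {u : ℝ} {i : Fin d} (h1 : a i ≤ b.repr x i + u)
    (h2 : b.repr x i + u < a i + 1) : x + u • b i ∈ box b a := by
  intro k
  rw [repr_add_smul]
  by_cases hk : k = i
  · subst hk; simpa using ⟨h1, h2⟩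
  · simpa [hk] using hx k

/-- First differences along one edge of the box. From a point in one half of the box one moves
towards the other half, so that the longer steps used by the comparison stay in the box. -/
theorem first_diff_axis (hp0 : 0 < p) {r : ℕ} (hr : 1 ≤ r) (θ : ℝ≥0∞) (hθ : 0 < θ) :
    ∃ C : ℝ≥0∞, C ≠ ∞ ∧ ∃ δ : ℝ, 0 < δ ∧ ∀ (b : Module.Basis (Fin d) ℝ (Space d)) (a : Fin d → ℝ)
      (g : Space d → ℝ), Adm p g → SmallDiff r p (box b a) b g → ∀ (i : Fin d) (u : ℝ), |u| ≤ δ →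
      fNorm p {x | x ∈ box b a ∧ x + u • b i ∈ box b a} (fun x => g (x + u • b i) - g x)
        ≤ C + θ * fNorm p (box b a) g := by
  obtain ⟨C, hC, δ, hδ, H⟩ := dyadicBound_zero (d := d) hp0 hr (θ / 2) (ENNReal.half_pos hθ.ne')
  refine ⟨C + C, by simp [hC], δ / 2, by positivity, fun b a g hg hsm i => ?_⟩
  set K := box b a with hK
  have hR : DiffSetup r p {x | x ∈ K ∧ b.repr x i < a i + 1 / 2} K ((1 / 2 : ℝ) • b i) g := by
    refine ⟨hg, fun x hx s hs hs' => ?_, fun u _ T hT => ?_⟩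
    · rw [smul_smul]
      exact add_smul_mem_box hx.1 (by linarith [(hx.1 i).1]) (by linarith [hx.2])
    · simp only [smul_smul] at hT ⊢
      refine hsm i _ T ?_
      simpa only [smul_smul] using hT
  have hL : DiffSetup r p {x | x ∈ K ∧ a i + 1 / 2 ≤ b.repr x i} K ((-(1 / 2) : ℝ) • b i) g := by
    refine ⟨hg, fun x hx s hs hs' => ?_, fun u _ T hT => ?_⟩
    · rw [smul_smul]
      exact add_smul_mem_box hx.1 (by linarith [hx.2]) (by linarith [(hx.1 i).2])
    · simp only [smul_smul] at hT ⊢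
      refine hsm i _ T ?_
      simpa only [smul_smul] using hT
  have hpos : ∀ u : ℝ, 0 ≤ u → u ≤ δ / 2 →
      fNorm p {x | x ∈ K ∧ x + u • b i ∈ K} (fun x => g (x + u • b i) - g x)
        ≤ C + C + θ * fNorm p K g := by
    intro u hu hu'
    have h1 := H _ K _ g hR (2 * u) (by positivity) (by linarith)
    have h2 := H _ K _ g hL (2 * u) (by positivity) (by linarith)
    have e1 : (2 * u) • ((1 / 2 : ℝ) • b i) = u • b i := by module
    have e2 : (2 * u) • ((-(1 / 2) : ℝ) • b i) = -(u • b i) := by module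
    rw [e1] at h1
    rw [e2] at h2
    have hsub : {x | x ∈ K ∧ x + u • b i ∈ K} ⊆ {x | x ∈ K ∧ b.repr x i < a i + 1 / 2} ∪
        {x | x + u • b i ∈ K ∧ a i + 1 / 2 ≤ b.repr x i} := by
      intro x hx
      rcases lt_or_ge (b.repr x i) (a i + 1 / 2) with h | h
      · exact Or.inl ⟨hx.1, h⟩
      · exact Or.inr ⟨hx.2, h⟩
    refine (fNorm_mono hsub _).trans ((fNorm_union_le hp0 _ _ _).trans ?_)
    have h1' : fNorm p {x | x ∈ K ∧ b.repr x i < a i + 1 / 2} (fun x => g (x + u • b i) - g x)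
        ≤ C + θ / 2 * fNorm p K g := by
      refine le_trans (le_of_eq ?_) h1
      congr 1
      funext x
      rw [dyadicPoly, shiftPoly_X_sub_one]
    have h2' : fNorm p {x | x + u • b i ∈ K ∧ a i + 1 / 2 ≤ b.repr x i}
        (fun x => g (x + u • b i) - g x) ≤ C + θ / 2 * fNorm p K g := by
      -- the difference at `x` is, up to sign, the backward difference at `x + u • b i`
      have h3 := fNorm_shift_le (p := p) (S := {x | x + u • b i ∈ K ∧ a i + 1 / 2 ≤ b.repr x i})
        (T := {x | x ∈ K ∧ a i + 1 / 2 ≤ b.repr x i}) (u • b i)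
        (fun x hx => ⟨hx.1, by rw [repr_add_smul]; simpa using by linarith [hx.2]⟩)
        (fun x => -(shiftPoly (-(u • b i)) (dyadicPoly 0) g x))
      refine le_trans (le_of_eq ?_) (h3.trans ((fNorm_neg _).le.trans h2))
      congr 1
      funext x
      rw [dyadicPoly, shiftPoly_X_sub_one]
      simp
    calc _ ≤ (C + θ / 2 * fNorm p K g) + (C + θ / 2 * fNorm p K g) := add_le_add h1' h2'
      _ = C + C + (θ / 2 + θ / 2) * fNorm p K g := by ring
      _ = _ := by rw [ENNReal.add_halves]
  intro u hu
  rcases le_total 0 u with h0 | h0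
  · exact hpos u h0 (by rwa [abs_of_nonneg h0] at hu)
  · have h1 := hpos (-u) (by linarith) (by rwa [abs_of_nonpos h0] at hu)
    have h3 := fNorm_shift_le (p := p) (S := {x | x ∈ K ∧ x + u • b i ∈ K})
      (T := {x | x ∈ K ∧ x + (-u) • b i ∈ K}) (u • b i)
      (fun x hx => ⟨hx.2, by simpa using hx.1⟩)
      (fun x => -(g (x + (-u) • b i) - g x))
    refine le_trans (le_of_eq ?_) (h3.trans ((fNorm_neg _).le.trans h1))
    congr 1
    funext x
    simp

/-- First differences along all small vectors, in terms of the coordinates of the vector. -/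
theorem first_diff_box (hp0 : 0 < p) {r : ℕ} (hr : 1 ≤ r) (θ : ℝ≥0∞) (hθ : 0 < θ) :
    ∃ C : ℝ≥0∞, C ≠ ∞ ∧ ∃ δ : ℝ, 0 < δ ∧ ∀ (b : Module.Basis (Fin d) ℝ (Space d)) (a : Fin d → ℝ)
      (g : Space d → ℝ), Adm p g → SmallDiff r p (box b a) b g → ∀ t : Fin d → ℝ,
      (∀ i, |t i| ≤ δ) →
      fNorm p {x | x ∈ box b a ∧ x + ∑ i, t i • b i ∈ box b a}
        (fun x => g (x + ∑ i, t i • b i) - g x) ≤ C + θ * fNorm p (box b a) g := by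
  obtain ⟨C, hC, δ, hδ, H⟩ := first_diff_axis (d := d) hp0 hr (θ / (d + 1))
    (ENNReal.div_pos hθ.ne' (by simp))
  refine ⟨d * C, ENNReal.mul_ne_top (by simp) hC, δ, hδ, fun b a g hg hsm t ht => ?_⟩
  have hrepr : ∀ (s : Finset (Fin d)) (x : Space d) (k : Fin d),
      b.repr (x + ∑ i ∈ s, t i • b i) k = b.repr x k + if k ∈ s then t k else 0 := by
    intro s x k
    simp [Finsupp.single_apply, Finset.sum_ite_eq']
  set K := box b a with hK
  set D := {x | x ∈ K ∧ x + ∑ i, t i • b i ∈ K} with hD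
  have hmem : ∀ (s : Finset (Fin d)), ∀ x ∈ D, x + ∑ i ∈ s, t i • b i ∈ K := by
    intro s x hx k
    have h1 := hx.1 k
    have h2 := hx.2 k
    rw [hrepr] at h2 ⊢
    simp only [Finset.mem_univ, if_true] at h2
    split_ifs
    · exact h2
    · simpa using h1
  have key : ∀ s : Finset (Fin d), fNorm p D (fun x => g (x + ∑ i ∈ s, t i • b i) - g x)
      ≤ s.card * (C + θ / (d + 1) * fNorm p K g) := by
    intro s
    induction s using Finset.induction_on with
    | empty => simp [fNorm_zero hp0]
    | insert k s hk ih =>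
      have h1 := fNorm_shift_le (p := p) (S := D)
        (T := {x | x ∈ K ∧ x + t k • b k ∈ K}) (∑ i ∈ s, t i • b i)
        (fun x hx => ⟨hmem s x hx, by
          have := hmem (insert k s) x hx
          rw [Finset.sum_insert hk] at this
          rwa [add_assoc, add_comm (∑ i ∈ s, t i • b i)]⟩)
        (fun x => g (x + t k • b k) - g x)
      have h2 := h1.trans (H b a g hg hsm k (t k) (ht k))
      have h3 := fNorm_add_le (S := D) hp0
        (((hg.shift (t k • b k)).sub hg).shift (∑ i ∈ s, t i • b i))
        ((hg.shift (∑ i ∈ s, t i • b i)).sub hg)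
      have e : (fun x => g (x + ∑ i ∈ insert k s, t i • b i) - g x) = fun x =>
          (g (x + ∑ i ∈ s, t i • b i + t k • b k) - g (x + ∑ i ∈ s, t i • b i))
            + (g (x + ∑ i ∈ s, t i • b i) - g x) := by
        funext x
        rw [Finset.sum_insert hk, add_assoc, add_comm (t k • b k)]
        ring
      rw [e, Finset.card_insert_of_notMem hk]
      refine (h3.trans (add_le_add h2 ih)).trans (le_of_eq ?_)
      push_cast
      ring
  refine (key Finset.univ).trans ?_
  rw [Finset.card_univ, Fintype.card_fin, mul_add, ← mul_assoc]
  gcongr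
  rw [← mul_div_assoc, mul_comm, mul_div_assoc]
  refine mul_le_of_le_one_right' ?_
  exact ENNReal.div_le_of_le_mul (by simp)

end

section

/-! ### Sampling on a random grid -/

theorem repr_sum_smul (b : Module.Basis (Fin d) ℝ (Space d)) (c : Fin d → ℝ) (k : Fin d) :
    b.repr (∑ i, c i • b i) k = c k := by
  rw [b.repr_sum_self]

theorem continuous_repr (b : Module.Basis (Fin d) ℝ (Space d)) (i : Fin d) :
    Continuous fun x => b.repr x i :=
  (b.coord i).continuous_of_finiteDimensional

/-- The half-open cell of side `s` with corner `a`, in the coordinates of the basis `b`. -/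
def cell (b : Module.Basis (Fin d) ℝ (Space d)) (a : Fin d → ℝ) (s : ℝ) : Set (Space d) :=
  {x | ∀ i, a i ≤ b.repr x i ∧ b.repr x i < a i + s}

/-- The open cube of vectors whose coordinates are less than `s` in absolute value. -/
def window (b : Module.Basis (Fin d) ℝ (Space d)) (s : ℝ) : Set (Space d) :=
  {x | ∀ i, |b.repr x i| < s}

theorem measurableSet_cell (b : Module.Basis (Fin d) ℝ (Space d)) (a : Fin d → ℝ) (s : ℝ) :
    MeasurableSet (cell b a s) := by
  simp only [cell, ofPred_forall, ofPred_and]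
  exact MeasurableSet.iInter fun i => ((isClosed_le continuous_const
    (continuous_repr b i)).measurableSet).inter
    ((isOpen_lt (continuous_repr b i) continuous_const).measurableSet)

theorem measurableSet_box (b : Module.Basis (Fin d) ℝ (Space d)) (a : Fin d → ℝ) :
    MeasurableSet (box b a) := measurableSet_cell b a 1

theorem isOpen_window (b : Module.Basis (Fin d) ℝ (Space d)) (s : ℝ) : IsOpen (window b s) := by
  simp only [window, ofPred_forall]
  exact isOpen_iInter_of_finite fun i => isOpen_lt (continuous_repr b i).abs continuous_const

theorem isCompact_coords (b : Module.Basis (Fin d) ℝ (Space d)) (l u : Fin d → ℝ) :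
    IsCompact {x | ∀ i, l i ≤ b.repr x i ∧ b.repr x i ≤ u i} := by
  have h := (b.equivFun.toContinuousLinearEquiv.toHomeomorph.isCompact_preimage).2
    (isCompact_Icc (a := l) (b := u))
  convert h using 1
  ext x
  simp only [mem_ofPred_eq, mem_preimage, mem_Icc, Pi.le_def, ← forall_and]
  rfl

theorem volume_cell_ne_top (b : Module.Basis (Fin d) ℝ (Space d)) (a : Fin d → ℝ) (s : ℝ) :
    volume (cell b a s) ≠ ∞ :=
  ne_top_of_le_ne_top (isCompact_coords b a (fun i => a i + s)).measure_lt_top.ne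
    (measure_mono fun _ hx i => ⟨(hx i).1, (hx i).2.le⟩)

theorem volume_window_ne_top (b : Module.Basis (Fin d) ℝ (Space d)) (s : ℝ) :
    volume (window b s) ≠ ∞ :=
  ne_top_of_le_ne_top (isCompact_coords b (fun _ => -s) (fun _ => s)).measure_lt_top.ne
    (measure_mono fun _ hx i => ⟨(abs_lt.1 (hx i)).1.le, (abs_lt.1 (hx i)).2.le⟩)

theorem volume_window_ne_zero (b : Module.Basis (Fin d) ℝ (Space d)) {s : ℝ} (hs : 0 < s) :
    volume (window b s) ≠ 0 :=
  ((isOpen_window b s).measure_pos volume ⟨0, fun i => by simpa using hs⟩).ne'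

/-- A cell of side `s` contains a translate of the cube `window b (s / 2)`, so its volume
is comparable to that of `window b s`, uniformly in `s`. -/
theorem volume_window_le (b : Module.Basis (Fin d) ℝ (Space d)) (a : Fin d → ℝ) (s : ℝ) :
    volume (window b s) ≤ 2 ^ d * volume (cell b a s) := by
  have h1 : window b s = (2 : ℝ) • window b (s / 2) := by
    ext x
    rw [mem_smul_set_iff_inv_smul_mem₀ (by norm_num)]
    simp only [window, mem_ofPred_eq, map_smul, Finsupp.smul_apply, smul_eq_mul, abs_mul]
    refine forall_congr' fun i => ?_
    norm_num
    constructor <;> intro h <;> linarith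
  have h2 : volume ((2 : ℝ) • window b (s / 2)) = 2 ^ d * volume (window b (s / 2)) := by
    rw [Measure.addHaar_smul]
    simp
  rw [h1, h2]
  refine mul_le_mul' le_rfl ?_
  have h3 : (fun x => x + ∑ i, (a i + s / 2) • b i) ⁻¹' cell b a s ⊇ window b (s / 2) := by
    intro x hx i
    have := abs_lt.1 (hx i)
    rw [map_add, Finsupp.add_apply, repr_sum_smul]
    constructor <;> linarith
  calc volume (window b (s / 2))
      ≤ volume ((fun x => x + ∑ i, (a i + s / 2) • b i) ⁻¹' cell b a s) := measure_mono h3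
    _ = volume (cell b a s) := measure_preimage_add_right _ _ _

theorem volume_cell_ne_zero (b : Module.Basis (Fin d) ℝ (Space d)) (a : Fin d → ℝ) {s : ℝ}
    (hs : 0 < s) : volume (cell b a s) ≠ 0 := by
  intro h
  have := volume_window_le b a s
  rw [h, mul_zero, nonpos_iff_eq_zero] at this
  exact volume_window_ne_zero b hs this

/-- The vector with coordinates `j i / N`. -/
noncomputable def gridPt (b : Module.Basis (Fin d) ℝ (Space d)) (N : ℕ) (j : Fin d → ℕ) :
    Space d :=
  ∑ i, ((j i : ℝ) / N) • b i

/-- The index of the cell of side `1 / N` that contains `x`. -/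
noncomputable def cellIdx (b : Module.Basis (Fin d) ℝ (Space d)) (a : Fin d → ℝ) (N : ℕ)
    (x : Space d) (i : Fin d) : ℕ :=
  ⌊N * (b.repr x i - a i)⌋₊

theorem measurable_gridPt_cellIdx (b : Module.Basis (Fin d) ℝ (Space d)) (a : Fin d → ℝ) (N : ℕ) :
    Measurable fun x => gridPt b N (cellIdx b a N x) := by
  unfold gridPt cellIdx
  refine Finset.measurable_fun_sum _ fun i _ => ?_
  refine Measurable.smul_const ?_ _
  refine Measurable.div_const ?_ _
  refine (measurable_from_nat (f := fun n : ℕ => (n : ℝ))).comp ?_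
  refine Nat.measurable_floor.comp ?_
  exact (((continuous_repr b i).sub continuous_const).measurable).const_mul _

theorem cellIdx_lt {b : Module.Basis (Fin d) ℝ (Space d)} {a : Fin d → ℝ} {N : ℕ} (hN : 1 ≤ N)
    {x : Space d} (hx : x ∈ box b a) (i : Fin d) : cellIdx b a N x i < N := by
  have hN' : (0 : ℝ) < N := by exact_mod_cast hN
  have := hx i
  refine (Nat.floor_lt (mul_nonneg hN'.le (by linarith))).2 ?_
  nlinarith

theorem add_gridPt_mem_box {b : Module.Basis (Fin d) ℝ (Space d)} {a : Fin d → ℝ} {N : ℕ}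
    (hN : 1 ≤ N) {y : Space d} (hy : y ∈ cell b a (1 / N)) {j : Fin d → ℕ} (hj : ∀ k, j k < N) :
    y + gridPt b N j ∈ box b a := by
  intro i
  have hN' : (0 : ℝ) < N := by exact_mod_cast hN
  rw [gridPt, map_add, Finsupp.add_apply, repr_sum_smul]
  have h1 := hy i
  have h2 : (j i : ℝ) + 1 ≤ N := by exact_mod_cast hj i
  have h3 : (j i : ℝ) / N + 1 / N ≤ 1 := by rw [← add_div, div_le_one hN']; exact h2
  have h4 : 0 ≤ (j i : ℝ) / N := by positivity
  constructor <;> linarith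

/-- A point of the box and the sampling point of its cell are `1 / N`-close in each coordinate. -/
theorem abs_repr_sub_lt {b : Module.Basis (Fin d) ℝ (Space d)} {a : Fin d → ℝ} {N : ℕ}
    (hN : 1 ≤ N) {x y : Space d} (hx : x ∈ box b a) (hy : y ∈ cell b a (1 / N)) (i : Fin d) :
    |b.repr (y + gridPt b N (cellIdx b a N x)) i - b.repr x i| < 1 / N := by
  have hN' : (0 : ℝ) < N := by exact_mod_cast hN
  have h0 := hx i
  have h1 := hy i
  rw [gridPt, map_add, Finsupp.add_apply, repr_sum_smul]
  have h2 := Nat.floor_le (mul_nonneg hN'.le (sub_nonneg.2 h0.1))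
  have h3 := Nat.lt_floor_add_one (N * (b.repr x i - a i))
  have h4 : (cellIdx b a N x i : ℝ) / N ≤ b.repr x i - a i := by
    rw [div_le_iff₀ hN', mul_comm]; exact h2
  have h5 : b.repr x i - a i < (cellIdx b a N x i : ℝ) / N + 1 / N := by
    rw [← add_div, lt_div_iff₀ hN', mul_comm]; exact h3
  rw [abs_lt]
  constructor <;> linarith

/-- Averaging over the position of the sampling point in a small cell. -/
theorem lintegral_sampling_le {b : Module.Basis (Fin d) ℝ (Space d)} {a : Fin d → ℝ} {N : ℕ}
    (hN : 1 ≤ N) {P : ℝ} {g : Space d → ℝ} (hg : Measurable g) {B : ℝ≥0∞}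
    (hB : ∀ t ∈ window b (1 / N),
      ∫⁻ x in {x | x ∈ box b a ∧ x + t ∈ box b a}, ‖g (x + t) - g x‖ₑ ^ P ≤ B) :
    ∫⁻ y in cell b a (1 / N), ∫⁻ x in box b a,
      ‖g x - g (y + gridPt b N (cellIdx b a N x))‖ₑ ^ P ≤ B * volume (window b (1 / N)) := by
  have hκ := measurable_gridPt_cellIdx b a N
  rw [lintegral_lintegral_swap (by
    refine Measurable.aemeasurable ?_
    refine Measurable.pow_const (Measurable.enorm ?_) _
    exact (hg.comp measurable_snd).sub (hg.comp (measurable_fst.add (hκ.comp measurable_snd))))]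
  have hcell := measurableSet_cell b a (1 / N)
  have hbox := measurableSet_box b a
  have hwin := (isOpen_window b (1 / N)).measurableSet
  calc ∫⁻ x in box b a, ∫⁻ y in cell b a (1 / N),
        ‖g x - g (y + gridPt b N (cellIdx b a N x))‖ₑ ^ P
      ≤ ∫⁻ x in box b a, ∫⁻ t in window b (1 / N),
          (box b a).indicator (fun z => ‖g z - g x‖ₑ ^ P) (x + t) := by
        refine setLIntegral_mono' hbox fun x hx => ?_
        -- for fixed `x`, substitute `t` for the difference of `x` and its sampling point
        rw [← lintegral_indicator hcell, ← lintegral_indicator hwin,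
          ← lintegral_add_right_eq_self _ (x - gridPt b N (cellIdx b a N x))]
        refine lintegral_mono fun t => ?_
        by_cases ht : t + (x - gridPt b N (cellIdx b a N x)) ∈ cell b a (1 / N)
        · have e : t + (x - gridPt b N (cellIdx b a N x)) + gridPt b N (cellIdx b a N x)
              = x + t := by abel
          have h1 : t ∈ window b (1 / N) := by
            intro i
            have := abs_repr_sub_lt hN hx ht i
            rw [e] at this
            simpa using this
          have h2 := add_gridPt_mem_box hN ht (cellIdx_lt hN hx)
          rw [e] at h2
          rw [indicator_of_mem ht, indicator_of_mem h1, indicator_of_mem h2, e,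
            enorm_sub_rev]
        · rw [indicator_of_notMem ht]
          exact zero_le
    _ = ∫⁻ t in window b (1 / N), ∫⁻ x in box b a,
          (box b a).indicator (fun z => ‖g z - g x‖ₑ ^ P) (x + t) := by
        refine lintegral_lintegral_swap (Measurable.aemeasurable ?_)
        have : (fun q : Space d × Space d =>
            (box b a).indicator (fun z => ‖g z - g q.1‖ₑ ^ P) (q.1 + q.2)) =
            ((fun q : Space d × Space d => q.1 + q.2) ⁻¹' box b a).indicator
              (fun q => ‖g (q.1 + q.2) - g q.1‖ₑ ^ P) := by
          funext q
          rfl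
        simp only [Function.uncurry_def]
        rw [this]
        refine Measurable.indicator ?_ (hbox.preimage (measurable_fst.add measurable_snd))
        exact (((hg.comp (measurable_fst.add measurable_snd)).sub
          (hg.comp measurable_fst)).enorm).pow_const _
    _ ≤ ∫⁻ _ in window b (1 / N), B := by
        refine setLIntegral_mono' hwin fun t ht => le_trans (le_of_eq ?_) (hB t ht)
        have hm : MeasurableSet {x : Space d | x + t ∈ box b a} :=
          hbox.preimage (measurable_add_const t)
        rw [show {x | x ∈ box b a ∧ x + t ∈ box b a} = {x : Space d | x + t ∈ box b a} ∩ box b a by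
          ext; simp [and_comm], ← Measure.restrict_restrict hm, ← lintegral_indicator hm]
        rfl
    _ = B * volume (window b (1 / N)) := by rw [setLIntegral_const]

/-- A point at which a function is at most its average, up to the `1` added to the numerator, which
makes measurability of the function unnecessary. -/
theorem exists_mem_le_of_lintegral_le {α : Type*} [MeasurableSpace α] {μ : Measure α} {s : Set α}
    (hs : MeasurableSet s) (h0 : μ s ≠ 0) (ht : μ s ≠ ∞) {H : α → ℝ≥0∞} {A : ℝ≥0∞} (hA : A ≠ ∞)
    (h : ∫⁻ x in s, H x ∂μ ≤ A) : ∃ x ∈ s, H x ≤ (A + 1) / μ s := by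
  by_contra! hc
  have h1 : ∫⁻ _ in s, (A + 1) / μ s ∂μ ≤ A :=
    (setLIntegral_mono' hs fun x hx => (hc x hx).le).trans h
  rw [setLIntegral_const, ENNReal.div_mul_cancel h0 ht] at h1
  exact absurd h1 (not_le.2 (ENNReal.lt_add_right hA one_ne_zero))

/-- The sampling lemma. If first differences along vectors shorter than `1 / N` are at most `B`,
then on some translate of the grid of side `1 / N` the values of `g` reproduce `g` up to a multiple
of `B` that does not depend on `N`, and the grid differences of order `r` are bounded. -/
theorem exists_sampling (hp0 : 0 < p) (r : ℕ) (b : Module.Basis (Fin d) ℝ (Space d))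
    (a : Fin d → ℝ) :
    ∃ C : ℝ≥0∞, C ≠ ∞ ∧ ∀ N : ℕ, 1 ≤ N → ∃ A : ℝ, ∀ (g : Space d → ℝ) (B : ℝ≥0∞), B ≠ 0 → B ≠ ∞ →
      Adm p g → SmallDiff r p (box b a) b g →
      (∀ t : Fin d → ℝ, (∀ i, |t i| ≤ 1 / N) →
        fNorm p {x | x ∈ box b a ∧ x + ∑ i, t i • b i ∈ box b a}
          (fun x => g (x + ∑ i, t i • b i) - g x) ≤ B) →
      ∃ y ∈ cell b a (1 / N),
        fNorm p (box b a) (fun x => g x - g (y + gridPt b N (cellIdx b a N x))) ≤ C * B ∧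
        ∀ (i : Fin d) (j : Fin d → ℕ), (∀ k, j k < N) → j i + r < N →
          |diff r ((1 / N : ℝ) • b i) g (y + gridPt b N j)| ≤ A := by
  -- the grid differences that occur only involve points of the box
  have hline : ∀ (N : ℕ), 1 ≤ N → ∀ y ∈ cell b a (1 / N), ∀ (i : Fin d) (j : Fin d → ℕ),
      (∀ k, j k < N) → j i + r < N → ∀ l : ℕ, l ≤ r →
      y + gridPt b N j + (l : ℝ) • ((1 / N : ℝ) • b i) ∈ box b a := by
    intro N hN y hy i j hj hjr l hl
    have hN' : (0 : ℝ) < N := by exact_mod_cast hN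
    rw [smul_smul]
    refine add_smul_mem_box (add_gridPt_mem_box hN hy hj) ?_ ?_
    · have := (add_gridPt_mem_box hN hy hj i).1
      have h2 : 0 ≤ (l : ℝ) * (1 / N) := by positivity
      linarith
    · rw [gridPt, map_add, Finsupp.add_apply, repr_sum_smul]
      have h1 := (hy i).2
      have h2 : (j i : ℝ) + l + 1 ≤ N := by exact_mod_cast (by omega : j i + l + 1 ≤ N)
      have h3 : (j i : ℝ) / N + l * (1 / N) + 1 / N ≤ 1 := by
        rw [mul_one_div, ← add_div, ← add_div, div_le_one hN']; exact h2
      linarith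
  by_cases hp : p = ∞
  · subst hp
    refine ⟨1, by simp, fun N hN => ⟨1, fun g B _ _ _ hsm hB => ?_⟩⟩
    have hN' : (0 : ℝ) < N := by exact_mod_cast hN
    have hy : ∑ i, a i • b i ∈ cell b a (1 / N) := by
      intro i
      rw [repr_sum_smul]
      exact ⟨le_rfl, by simpa using hN'⟩
    refine ⟨_, hy, ?_, fun i j hj hjr => ?_⟩
    · rw [fNorm_top, one_mul]
      refine iSup₂_le fun x hx => ?_
      set z := ∑ i, a i • b i + gridPt b N (cellIdx b a N x) with hz
      have hzb : z ∈ box b a := add_gridPt_mem_box hN hy (cellIdx_lt hN hx)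
      have h1 := hB (fun i => b.repr (z - x) i) fun i => by
        simpa only [map_sub, Finsupp.sub_apply, hz] using (abs_repr_sub_lt hN hx hy i).le
      rw [b.sum_repr, fNorm_top] at h1
      have h2 := (le_iSup₂ (f := fun w (_ : w ∈ {w | w ∈ box b a ∧ w + (z - x) ∈ box b a}) =>
        ‖g (w + (z - x)) - g w‖ₑ) x ⟨hx, by simpa using hzb⟩).trans h1
      rw [enorm_sub_rev]
      simpa using h2
    · have h1 := hsm i (1 / N) {∑ i, a i • b i + gridPt b N j} fun x hx => by
        rw [mem_singleton_iff.1 hx]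
        exact hline N hN _ hy i j hj hjr
      rw [fNorm_top] at h1
      simp only [mem_singleton_iff, iSup_iSup_eq_left] at h1
      rw [Real.enorm_eq_ofReal_abs, ENNReal.ofReal_le_one] at h1
      exact h1
  · have hP : 0 < p.toReal := ENNReal.toReal_pos hp0.ne' hp
    set P := p.toReal with hPdef
    set e : ℝ := fExp p / P with he
    have he0 : 0 < e := div_pos (fExp_pos hp0) hP
    refine ⟨(3 * 2 ^ d) ^ e, ENNReal.rpow_ne_top_of_nonneg he0.le (by finiteness), fun N hN => ?_⟩
    have hN' : (0 : ℝ) < N := by exact_mod_cast hN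
    have hs : (0 : ℝ) < 1 / N := by positivity
    set v := volume (cell b a (1 / N)) with hv
    have hv0 : v ≠ 0 := volume_cell_ne_zero b a hs
    have hvt : v ≠ ∞ := volume_cell_ne_top b a _
    set W := volume (window b (1 / N)) with hW
    have hW0 : W ≠ 0 := volume_window_ne_zero b hs
    have hWt : W ≠ ∞ := volume_window_ne_top b _
    set I : Finset (Fin d × (Fin d → Fin N)) :=
      Finset.univ.filter fun q => (q.2 q.1 : ℕ) + r < N with hI
    set A : ℝ≥0∞ := ((I.card + 1) * (3 / v)) ^ P⁻¹ with hA
    have hAt : A ≠ ∞ := ENNReal.rpow_ne_top_of_nonneg (by positivity)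
      (ENNReal.mul_ne_top (by finiteness) (ENNReal.div_ne_top (by simp) hv0))
    refine ⟨A.toReal, fun g B hB0 hBt hg hsm hB => ?_⟩
    have hgm := hg hp
    -- pass from bounds on the `F`-norm to bounds on integrals
    have conv : ∀ (T : Set (Space d)) (f : Space d → ℝ) (c : ℝ≥0∞),
        fNorm p T f ≤ c ↔ ∫⁻ x in T, ‖f x‖ₑ ^ P ≤ c ^ e⁻¹ := by
      intro T f c
      rw [fNorm_of_ne_top hp0 hp, ← hPdef, ← he, ENNReal.le_rpow_inv_iff he0]
    set B' := B ^ e⁻¹ with hB'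
    have hB'0 : B' ≠ 0 := by
      rw [hB', Ne, ENNReal.rpow_eq_zero_iff]
      simp [hB0, hBt]
    have hB't : B' ≠ ∞ := ENNReal.rpow_ne_top_of_nonneg (by positivity) hBt
    have h1 := lintegral_sampling_le (a := a) (P := P) hN hgm (B := B') fun t ht => by
      have := hB (fun i => b.repr t i) fun i => (ht i).le
      rw [b.sum_repr, conv] at this
      exact this
    set Φ : Space d → ℝ≥0∞ := fun y => ∫⁻ x in box b a,
      ‖g x - g (y + gridPt b N (cellIdx b a N x))‖ₑ ^ P with hΦ
    set Ψ : Fin d × (Fin d → Fin N) → Space d → ℝ≥0∞ := fun q y =>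
      ‖diff r ((1 / N : ℝ) • b q.1) g (y + gridPt b N fun k => (q.2 k : ℕ))‖ₑ ^ P with hΨ
    have hΨm : ∀ q, Measurable (Ψ q) := fun q =>
      ((((hg.diff r _).shift _) hp).enorm).pow_const _
    have h2 : ∀ q ∈ I, ∫⁻ y in cell b a (1 / N), Ψ q y ≤ 1 := by
      intro q hq
      have hq' : (q.2 q.1 : ℕ) + r < N := (Finset.mem_filter.1 hq).2
      have h3 := (fNorm_shift_le (p := p) (S := cell b a (1 / N))
        (T := {x | ∀ l : ℕ, l ≤ r → x + (l : ℝ) • ((1 / N : ℝ) • b q.1) ∈ box b a})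
        (gridPt b N fun k => (q.2 k : ℕ))
        (fun y hy l hl => hline N hN y hy q.1 _ (fun k => (q.2 k).2) hq' l hl)
        (diff r ((1 / N : ℝ) • b q.1) g)).trans (hsm q.1 (1 / N) _ fun x hx => hx)
      rw [conv, ENNReal.one_rpow] at h3
      exact h3
    have hSm : Measurable fun y => (∑ q ∈ I, Ψ q y) / (I.card + 1) :=
      (Finset.measurable_fun_sum _ fun q _ => hΨm q).div_const _
    -- the weights give both terms an average that is bounded independently of `N`, up to the volume
    have h3 : ∫⁻ y in cell b a (1 / N), (Φ y / (B' * W) + (∑ q ∈ I, Ψ q y) / (I.card + 1))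
        ≤ 1 + 1 := by
      have hdiv : ∀ (F : Space d → ℝ≥0∞) (c : ℝ≥0∞), c ≠ 0 →
          ∫⁻ y in cell b a (1 / N), F y / c = (∫⁻ y in cell b a (1 / N), F y) / c := by
        intro F c hc
        simp only [div_eq_mul_inv]
        exact lintegral_mul_const' _ _ (ENNReal.inv_ne_top.2 hc)
      rw [lintegral_add_right _ hSm, hdiv _ _ (mul_ne_zero hB'0 hW0),
        hdiv _ _ (by positivity), lintegral_finsetSum _ fun q _ => hΨm q]
      refine add_le_add (ENNReal.div_le_of_le_mul (by rw [one_mul]; exact h1))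
        (ENNReal.div_le_of_le_mul ?_)
      rw [one_mul]
      refine (Finset.sum_le_sum h2).trans ?_
      simp
    obtain ⟨y, hy, hle⟩ := exists_mem_le_of_lintegral_le (measurableSet_cell b a (1 / N))
      hv0 hvt (by finiteness) h3
    rw [show (1 + 1 + 1 : ℝ≥0∞) = 3 by norm_num] at hle
    refine ⟨y, hy, ?_, fun i j hj hjr => ?_⟩
    · have h4 : Φ y ≤ 3 * 2 ^ d * B' := by
        have h5 : Φ y ≤ 3 / v * (B' * W) := by
          have := (le_self_add).trans hle
          rwa [ENNReal.div_le_iff (mul_ne_zero hB'0 hW0) (ENNReal.mul_ne_top hB't hWt)] at this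
        refine h5.trans ?_
        calc 3 / v * (B' * W) ≤ 3 / v * (B' * (2 ^ d * v)) := by
              gcongr
              exact volume_window_le b a _
          _ = 3 * 2 ^ d * B' * (v⁻¹ * v) := by rw [div_eq_mul_inv]; ring
          _ = 3 * 2 ^ d * B' := by rw [ENNReal.inv_mul_cancel hv0 hvt, mul_one]
      rw [conv, ENNReal.mul_rpow_of_nonneg _ _ (by positivity), ← ENNReal.rpow_mul,
        mul_inv_cancel₀ he0.ne', ENNReal.rpow_one]
      exact h4
    · set q : Fin d × (Fin d → Fin N) := (i, fun k => ⟨j k, hj k⟩) with hq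
      have hqI : q ∈ I := by simp [hI, hq, hjr]
      have h5 : Ψ q y ≤ 3 / v * (I.card + 1) := by
        have h6 := (le_add_self).trans hle
        rw [ENNReal.div_le_iff (by positivity) (by finiteness)] at h6
        exact (Finset.single_le_sum (f := fun q => Ψ q y) (fun _ _ => zero_le) hqI).trans h6
      have h7 : ‖diff r ((1 / N : ℝ) • b i) g (y + gridPt b N j)‖ₑ ≤ A := by
        rw [hA, ENNReal.le_rpow_inv_iff hP, mul_comm]
        exact h5
      rw [Real.enorm_eq_ofReal_abs] at h7
      exact (ENNReal.ofReal_le_iff_le_toReal hAt).1 h7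

end

section

open Polynomial

/-! ### Functions that are polynomial on every line -/

/-- Along a line, `diff` is the iterated forward difference of the restriction. -/
theorem diff_eq_fwdDiff {f : Space d → ℝ} {x ξ : Space d} {Q : ℝ[X]}
    (hQ : ∀ t : ℝ, f (x + t • ξ) = Q.eval t) (r : ℕ) (u s : ℝ) :
    diff r (u • ξ) f (x + (u * s) • ξ) = (fwdDiff 1)^[r] (Q.comp (C u * X)).eval s := by
  rw [fwdDiff_iter_eq_sum_shift, diff]
  refine Finset.sum_congr rfl fun j hj => ?_
  have hj' : j ≤ r := Nat.lt_succ_iff.1 (Finset.mem_range.1 hj)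
  have : x + (u * s) • ξ + (j : ℝ) • (u • ξ) = x + (u * (s + j)) • ξ := by module
  rw [this, hQ, neg_one_pow_add_eq_sub hj']
  simp [eval_comp]

theorem diff_eq_zero_of_degree_lt {f : Space d → ℝ} {x ξ : Space d} {r : ℕ} (hr : 1 ≤ r)
    {Q : ℝ[X]} (hd : Q.degree < (r : WithBot ℕ)) (hQ : ∀ t : ℝ, f (x + t • ξ) = Q.eval t)
    (u : ℝ) : diff r (u • ξ) f x = 0 := by
  have h := diff_eq_fwdDiff hQ r u 0
  rw [mul_zero, zero_smul, add_zero] at h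
  rw [h, Polynomial.fwdDiff_iter_eq_zero_of_degree_lt]
  · rfl
  · have h1 : Q.natDegree < r := by
      by_cases h0 : Q = 0
      · subst h0; rw [natDegree_zero]; exact hr
      · exact (natDegree_lt_iff_degree_lt h0).2 hd
    refine lt_of_le_of_lt natDegree_comp_le (lt_of_le_of_lt ?_ h1)
    exact mul_le_of_le_one_right (Nat.zero_le _) ((natDegree_C_mul_le u X).trans natDegree_X_le)

/-- A polynomial annihilated by one nonzero difference of order `r` has degree less than `r`. -/
theorem degree_lt_of_diff_eq_zero {f : Space d → ℝ} {x ξ : Space d} {r : ℕ} {Q : ℝ[X]}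
    (hQ : ∀ t : ℝ, f (x + t • ξ) = Q.eval t) {u : ℝ} (hu : u ≠ 0)
    (h : ∀ y, diff r (u • ξ) f y = 0) : Q.degree < (r : WithBot ℕ) := by
  by_contra hd
  have hQ0 : Q ≠ 0 := by
    rintro rfl
    simp at hd
  set Q' := Q.comp (C u * X) with hQ'
  have hdeg : Q'.natDegree = Q.natDegree := by
    rw [hQ', natDegree_comp, natDegree_C_mul_X u hu, mul_one]
  have hQ'0 : Q' ≠ 0 := by
    intro h0
    rw [hQ', comp_eq_zero_iff] at h0
    rcases h0 with h0 | ⟨-, h0⟩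
    · exact hQ0 h0
    · have := congrArg (fun P => coeff P 1) h0
      simp at this
      exact hu this
  have hrn : r ≤ Q'.natDegree := by
    rw [hdeg]
    by_contra hlt
    exact hd ((natDegree_lt_iff_degree_lt hQ0).1 (not_le.1 hlt))
  have hz : (fwdDiff 1)^[r] Q'.eval = fun _ => 0 := by
    funext s
    rw [← diff_eq_fwdDiff hQ r u s, h]
  have h1 := Polynomial.fwdDiff_iter_degree_eq_factorial Q'
  obtain ⟨k, hk⟩ := Nat.exists_eq_add_of_le hrn
  have h2 : (fwdDiff (1 : ℝ))^[k] (fun _ : ℝ => (0 : ℝ)) = fun _ => 0 := by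
    funext s
    simp [fwdDiff_iter_eq_sum_shift]
  rw [hk, add_comm r k, Function.iterate_add_apply, hz, h2] at h1
  have h3 := congrFun h1 0
  simp only [Pi.smul_apply, Pi.natCast_apply, smul_eq_mul] at h3
  exact mul_ne_zero (leadingCoeff_ne_zero.2 hQ'0)
    (by exact_mod_cast Nat.factorial_ne_zero _) h3.symm

/-- The restriction of `f` to every line is a polynomial, of some degree. -/
def LinePoly (f : Space d → ℝ) : Prop :=
  ∀ x ξ : Space d, ∃ Q : ℝ[X], ∀ t : ℝ, f (x + t • ξ) = Q.eval t

theorem LinePoly.diff {f : Space d → ℝ} (hf : LinePoly f) (r : ℕ) (h : Space d) :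
    LinePoly (DirWhitney.diff r h f) := by
  intro x ξ
  choose Q hQ using fun j : ℕ => hf (x + (j : ℝ) • h) ξ
  refine ⟨∑ j ∈ Finset.range (r + 1), C ((-1 : ℝ) ^ (r + j) * (r.choose j : ℝ)) * Q j,
    fun t => ?_⟩
  rw [DirWhitney.diff, eval_finsetSum]
  refine Finset.sum_congr rfl fun j _ => ?_
  rw [eval_mul, eval_C, ← hQ, add_right_comm]

/-- The identity principle: join a given point to the open set by a line. -/
theorem LinePoly.eq_zero {f : Space d → ℝ} (hf : LinePoly f) {U : Set (Space d)} (hU : IsOpen U)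
    (hne : U.Nonempty) (h : ∀ x ∈ U, f x = 0) (x : Space d) : f x = 0 := by
  obtain ⟨x₀, hx₀⟩ := hne
  obtain ⟨Q, hQ⟩ := hf x₀ (x - x₀)
  have hc : Continuous fun t : ℝ => x₀ + t • (x - x₀) := by fun_prop
  have hev : ∀ᶠ t : ℝ in nhds 0, Q.eval t = 0 := by
    have := (hU.preimage hc).mem_nhds (x := 0) (by simpa using hx₀)
    filter_upwards [this] with t ht
    rw [← hQ]
    exact h _ ht
  have hQ0 : Q = 0 := Polynomial.eq_zero_of_infinite_isRoot Q
    (infinite_of_mem_nhds (0 : ℝ) hev)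
  have := hQ 1
  simpa [hQ0] using this

/-! ### Tensor product polynomials -/

/-- The polynomial of degree less than `r` in each coordinate with respect to the basis `b`, with
coefficients `c`. -/
noncomputable def tpoly {r : ℕ} (b : Module.Basis (Fin d) ℝ (Space d))
    (c : (Fin d → Fin r) → ℝ) (x : Space d) : ℝ :=
  ∑ α, c α * ∏ i, b.repr x i ^ (α i : ℕ)

variable {r : ℕ} (b : Module.Basis (Fin d) ℝ (Space d))

theorem tpoly_add (c c' : (Fin d → Fin r) → ℝ) (x : Space d) :
    tpoly b (c + c') x = tpoly b c x + tpoly b c' x := by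
  simp [tpoly, add_mul, Finset.sum_add_distrib]

theorem tpoly_sub (c c' : (Fin d → Fin r) → ℝ) (x : Space d) :
    tpoly b (c - c') x = tpoly b c x - tpoly b c' x := by
  simp [tpoly, sub_mul, Finset.sum_sub_distrib]

theorem tpoly_smul (s : ℝ) (c : (Fin d → Fin r) → ℝ) (x : Space d) :
    tpoly b (s • c) x = s * tpoly b c x := by
  simp [tpoly, mul_assoc, Finset.mul_sum]

theorem continuous_tpoly (c : (Fin d → Fin r) → ℝ) : Continuous (tpoly b c) := by
  unfold tpoly
  exact continuous_finsetSum _ fun α _ => continuous_const.mul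
    (continuous_finsetProd _ fun i _ => (continuous_repr b i).pow _)

theorem adm_tpoly (c : (Fin d → Fin r) → ℝ) : Adm p (tpoly b c) :=
  Adm.of_continuous (continuous_tpoly b c)

/-- The restriction of a tensor product polynomial to a line. -/
noncomputable def tpolyLine (c : (Fin d → Fin r) → ℝ) (x ξ : Space d) : ℝ[X] :=
  ∑ α, C (c α) * ∏ i, (C (b.repr ξ i) * X + C (b.repr x i)) ^ (α i : ℕ)

theorem tpoly_line (c : (Fin d → Fin r) → ℝ) (x ξ : Space d) (t : ℝ) :
    tpoly b c (x + t • ξ) = (tpolyLine b c x ξ).eval t := by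
  simp only [tpoly, tpolyLine, eval_finsetSum, eval_mul, eval_C, eval_prod, eval_pow, eval_add,
    eval_X, map_add, map_smul, Finsupp.add_apply, Finsupp.smul_apply, smul_eq_mul]
  refine Finset.sum_congr rfl fun α _ => ?_
  congr 1
  refine Finset.prod_congr rfl fun i _ => ?_
  ring

theorem linePoly_tpoly (c : (Fin d → Fin r) → ℝ) : LinePoly (tpoly b c) :=
  fun x ξ => ⟨_, tpoly_line b c x ξ⟩

theorem degree_tpolyLine_lt (c : (Fin d → Fin r) → ℝ) (x : Space d) (i : Fin d) :
    (tpolyLine b c x (b i)).degree < (r : WithBot ℕ) := by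
  refine lt_of_le_of_lt (degree_sum_le _ _) ?_
  rw [Finset.sup_lt_iff (by exact_mod_cast WithBot.bot_lt_coe r)]
  intro α _
  rw [Finset.prod_eq_mul_prod_sdiff_singleton_of_mem (Finset.mem_univ i)]
  have h1 : ∏ k ∈ Finset.univ \ {i}, (C (b.repr (b i) k) * X + C (b.repr x k)) ^ (α k : ℕ)
      = C (∏ k ∈ Finset.univ \ {i}, (b.repr x k) ^ (α k : ℕ)) := by
    rw [map_prod]
    refine Finset.prod_congr rfl fun k hk => ?_
    have hki : i ≠ k := by
      rintro rfl
      simp at hk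
    simp [hki]
  rw [h1, mul_comm _ (C _), ← mul_assoc, ← map_mul]
  refine lt_of_le_of_lt (degree_mul_le _ _) ?_
  refine lt_of_le_of_lt (add_le_add degree_C_le le_rfl) ?_
  rw [zero_add]
  refine lt_of_le_of_lt (degree_pow_le _ _) ?_
  refine lt_of_le_of_lt (nsmul_le_nsmul_right (degree_linear_le) _) ?_
  simp only [nsmul_eq_mul, mul_one]
  exact_mod_cast (α i).2

theorem diff_tpoly (hr : 1 ≤ r) (c : (Fin d → Fin r) → ℝ) (i : Fin d) (u : ℝ) (x : Space d) :
    diff r (u • b i) (tpoly b c) x = 0 :=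
  diff_eq_zero_of_degree_lt hr (degree_tpolyLine_lt b c x i) (tpoly_line b c x (b i)) u

theorem prod_eval_eq_tpoly (P : Fin d → ℝ[X]) (hP : ∀ i, (P i).natDegree < r) (x : Space d) :
    ∏ i, (P i).eval (b.repr x i) = tpoly b (fun α : Fin d → Fin r => ∏ i, (P i).coeff (α i)) x := by
  have h1 : ∀ i, (P i).eval (b.repr x i) = ∑ k : Fin r, (P i).coeff k * b.repr x i ^ (k : ℕ) := by
    intro i
    rw [eval_eq_sum_range' (hP i), Finset.sum_range]
  simp only [h1, Finset.prod_univ_sum, tpoly, Fintype.piFinset_univ, ← Finset.prod_mul_distrib]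

/-- Tensor product Lagrange interpolation on the first `r ^ d` points of a grid. -/
theorem exists_tpoly_interpolating {N : ℕ} (hN : 1 ≤ N) (y : Space d)
    (v : (Fin d → ℕ) → ℝ) : ∃ c : (Fin d → Fin r) → ℝ,
      ∀ j : Fin d → ℕ, (∀ k, j k < r) → tpoly b c (y + gridPt b N j) = v j := by
  have hN' : (0 : ℝ) < N := by exact_mod_cast hN
  set node : Fin d → Fin r → ℝ := fun i k => b.repr y i + (k : ℝ) / N with hnode
  have hinj : ∀ i, Function.Injective (node i) := by
    intro i k l h
    simp only [hnode, add_right_inj, div_left_inj' hN'.ne', Nat.cast_inj] at h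
    exact Fin.ext h
  set L : (Fin d → Fin r) → Fin d → ℝ[X] := fun α i =>
    Lagrange.basis Finset.univ (node i) (α i) with hL
  have hLdeg : ∀ α i, (L α i).natDegree < r := by
    intro α i
    rw [hL, Lagrange.natDegree_basis (hinj i).injOn (Finset.mem_univ _), Finset.card_univ,
      Fintype.card_fin]
    have := (α i).2
    omega
  refine ⟨∑ α, v (fun i => (α i : ℕ)) • fun β : Fin d → Fin r => ∏ i, (L α i).coeff (β i), ?_⟩
  intro j hj
  have hsum : ∀ (s : Finset (Fin d → Fin r)) (x : Space d),
      tpoly b (∑ α ∈ s, v (fun i => (α i : ℕ)) • fun β : Fin d → Fin r =>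
        ∏ i, (L α i).coeff (β i)) x
      = ∑ α ∈ s, v (fun i => (α i : ℕ)) * ∏ i, (L α i).eval (b.repr x i) := by
    intro s x
    induction s using Finset.induction_on with
    | empty => simp [tpoly]
    | insert α s hα ih =>
      rw [Finset.sum_insert hα, Finset.sum_insert hα, tpoly_add, tpoly_smul, ih,
        prod_eval_eq_tpoly b (L α) (hLdeg α)]
  set j' : Fin d → Fin r := fun k => ⟨j k, hj k⟩ with hj'
  have hx : ∀ i, b.repr (y + gridPt b N j) i = node i (j' i) := by
    intro i
    rw [gridPt, map_add, Finsupp.add_apply, repr_sum_smul]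
  rw [hsum, Finset.sum_eq_single j']
  · have : ∀ i, (L j' i).eval (b.repr (y + gridPt b N j) i) = 1 := by
      intro i
      rw [hx, hL]
      exact Lagrange.eval_basis_self (hinj i).injOn (Finset.mem_univ _)
    rw [Finset.prod_congr rfl fun i _ => this i, Finset.prod_const_one, mul_one]
  · intro α _ hα
    obtain ⟨i, hi⟩ := Function.ne_iff.1 hα
    rw [Finset.prod_eq_zero (Finset.mem_univ i), mul_zero]
    rw [hx, hL]
    exact Lagrange.eval_basis_of_ne hi (Finset.mem_univ _)
  · simp

/-! ### Grid functions with bounded differences -/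

/-- A grid function that vanishes on the first `r ^ d` points and has bounded differences of order
`r` in each coordinate is bounded, as its values are recovered one after the other. -/
theorem abs_le_of_grid_diff {N r : ℕ} {A : ℝ} (hA : 0 ≤ A) (e : (Fin d → ℕ) → ℝ)
    (h0 : ∀ j : Fin d → ℕ, (∀ k, j k < r) → e j = 0)
    (hd : ∀ (i : Fin d) (j : Fin d → ℕ), (∀ k, j k < N) → j i + r < N →
      |∑ l ∈ Finset.range (r + 1), (-1 : ℝ) ^ (r + l) * (r.choose l : ℝ)
        * e (Function.update j i (j i + l))| ≤ A) :
    ∀ (m : ℕ) (j : Fin d → ℕ), (∀ k, j k < N) → ∑ k, j k ≤ m → |e j| ≤ A * (2 ^ r + 1) ^ m := by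
  intro m
  induction m with
  | zero =>
    intro j hj hm
    rcases Nat.eq_zero_or_pos r with hr | hr
    · subst hr
      rcases isEmpty_or_nonempty (Fin d) with he | ⟨⟨i⟩⟩
      · rw [h0 j fun k => he.elim k]; simpa using hA
      · simpa using hd i j hj (by simpa using hj i)
    · have hz : ∀ k, j k = 0 := by simpa using hm
      rw [h0 j fun k => by rw [hz k]; exact hr]
      simpa using hA
  | succ m ih =>
    intro j hj hm
    by_cases hall : ∀ k, j k < r
    · rw [h0 j hall, abs_zero]; positivity
    push Not at hall
    obtain ⟨i, hi⟩ := hall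
    set j' := Function.update j i (j i - r) with hj'
    have hj'i : j' i = j i - r := by simp [hj']
    have hup : ∀ l, Function.update j' i (j' i + l) = Function.update j i (j i - r + l) := by
      intro l
      rw [hj'i, hj', Function.update_idem]
    have h1 := hd i j' (fun k => by
      by_cases hk : k = i
      · subst hk; rw [hj'i]; exact lt_of_le_of_lt (Nat.sub_le _ _) (hj k)
      · rw [hj', Function.update_of_ne hk]; exact hj k) (by rw [hj'i]; have := hj i; omega)
    simp only [hup] at h1
    rw [Finset.sum_range_succ, Nat.sub_add_cancel hi, Function.update_eq_self] at h1
    have hsum : ∀ l, ∑ k, Function.update j i l k + j i = ∑ k, j k + l := by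
      intro l
      rw [← Finset.sum_erase_add _ _ (Finset.mem_univ i),
        ← Finset.sum_erase_add (Finset.univ) j (Finset.mem_univ i), Function.update_self]
      have : ∑ k ∈ Finset.univ.erase i, Function.update j i l k = ∑ k ∈ Finset.univ.erase i, j k :=
        Finset.sum_congr rfl fun k hk => Function.update_of_ne (Finset.ne_of_mem_erase hk) _ _
      omega
    have h2 : ∀ l ∈ Finset.range r, |(-1 : ℝ) ^ (r + l) * (r.choose l : ℝ)
        * e (Function.update j i (j i - r + l))| ≤ r.choose l * (A * (2 ^ r + 1) ^ m) := by
      intro l hl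
      have hl' := Finset.mem_range.1 hl
      rw [abs_mul, abs_mul, abs_pow, abs_neg, abs_one, one_pow, one_mul, Nat.abs_cast]
      refine mul_le_mul_of_nonneg_left (ih _ (fun k => ?_) ?_) (by positivity)
      · by_cases hk : k = i
        · subst hk; rw [Function.update_self]; have := hj k; omega
        · rw [Function.update_of_ne hk]; exact hj k
      · have := hsum (j i - r + l)
        omega
    have h3 : |∑ l ∈ Finset.range r, (-1 : ℝ) ^ (r + l) * (r.choose l : ℝ)
        * e (Function.update j i (j i - r + l))| ≤ 2 ^ r * (A * (2 ^ r + 1) ^ m) := by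
      refine (Finset.abs_sum_le_sum_abs _ _).trans ((Finset.sum_le_sum h2).trans ?_)
      rw [← Finset.sum_mul]
      refine mul_le_mul_of_nonneg_right ?_ (by positivity)
      have := Nat.sum_range_choose r
      rw [Finset.sum_range_succ] at this
      have h4 : ∑ l ∈ Finset.range r, r.choose l ≤ 2 ^ r := by omega
      exact_mod_cast h4
    have h5 : (-1 : ℝ) ^ (r + r) * (r.choose r : ℝ) * e j = e j := by
      rw [← two_mul, pow_mul]
      simp
    rw [h5] at h1
    have h6 : |e j| ≤ A + 2 ^ r * (A * (2 ^ r + 1) ^ m) := by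
      rw [abs_le] at h1 h3 ⊢
      constructor <;> linarith [h1.1, h1.2, h3.1, h3.2]
    refine h6.trans ?_
    have h7 : A ≤ A * (2 ^ r + 1) ^ m :=
      le_mul_of_one_le_right hA (one_le_pow₀ (by linarith [pow_pos (two_pos (α := ℝ)) r]))
    rw [pow_succ]
    linarith

/-! ### A finite-dimensional estimate -/

/-- A subadditive, `q`-homogeneous and bounded functional on `ℝ^ι` dominates the distance to its
kernel. -/
theorem exists_kernel_approx {ι : Type*} [Fintype ι] {q : ℝ} (hq : 0 < q)
    (μ : (ι → ℝ) → ℝ≥0∞) (hadd : ∀ v w, μ (v + w) ≤ μ v + μ w)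
    (hsmul : ∀ (s : ℝ) (v), μ (s • v) = ‖s‖ₑ ^ q * μ v) {C : ℝ≥0∞} (hC : C ≠ ∞)
    (hbd : ∀ v, μ v ≤ C * ‖v‖ₑ ^ q) :
    ∃ C' : ℝ≥0∞, C' ≠ ∞ ∧ ∀ v, ∃ z, μ z = 0 ∧ ‖v - z‖ₑ ^ q ≤ C' * μ v := by
  have hfin : ∀ v, μ v ≠ ∞ := fun v => ne_top_of_le_ne_top
    (ENNReal.mul_ne_top hC (ENNReal.rpow_ne_top_of_nonneg hq.le (by simp))) (hbd v)
  have hneg : ∀ v, μ (-v) = μ v := by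
    intro v
    have := hsmul (-1) v
    simpa using this
  let Z : Submodule ℝ (ι → ℝ) :=
    { carrier := {v | μ v = 0}
      add_mem' := by
        intro v w hv hw
        have := hadd v w
        rw [show μ v = 0 from hv, show μ w = 0 from hw] at this
        simpa using this
      zero_mem' := by
        have := hsmul 0 0
        simpa [ENNReal.zero_rpow_of_pos hq] using this
      smul_mem' := by
        intro s v hv
        change μ (s • v) = 0
        rw [hsmul, show μ v = 0 from hv, mul_zero] }
  obtain ⟨W, hW⟩ := Z.exists_isCompl
  have hcont : Continuous fun v => (μ v).toReal := by
    have hkey : ∀ v w, (μ v).toReal ≤ (μ w).toReal + C.toReal * ‖v - w‖ ^ q := by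
      intro v w
      have h1 : μ v ≤ μ w + C * ‖v - w‖ₑ ^ q := by
        calc μ v = μ (w + (v - w)) := by rw [add_sub_cancel]
          _ ≤ μ w + μ (v - w) := hadd _ _
          _ ≤ _ := by gcongr; exact hbd _
      have h2 : C * ‖v - w‖ₑ ^ q ≠ ∞ :=
        ENNReal.mul_ne_top hC (ENNReal.rpow_ne_top_of_nonneg hq.le (by simp))
      have h3 := ENNReal.toReal_mono (ENNReal.add_ne_top.2 ⟨hfin w, h2⟩) h1
      rw [ENNReal.toReal_add (hfin w) h2, ENNReal.toReal_mul, ← ENNReal.toReal_rpow,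
        toReal_enorm] at h3
      exact h3
    rw [continuous_iff_continuousAt]
    intro w
    have ht : Filter.Tendsto (fun v => C.toReal * ‖v - w‖ ^ q) (nhds w) (nhds 0) := by
      have h4 : Continuous fun v : ι → ℝ => C.toReal * ‖v - w‖ ^ q :=
        continuous_const.mul ((continuous_id.sub continuous_const).norm.rpow_const
          fun _ => Or.inr hq.le)
      have := h4.tendsto w
      simpa [Real.zero_rpow hq.ne'] using this
    rw [ContinuousAt, tendsto_iff_dist_tendsto_zero]
    refine squeeze_zero (fun _ => dist_nonneg) (fun v => ?_) ht
    rw [Real.dist_eq, abs_le]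
    have h5 := hkey v w
    have h6 := hkey w v
    rw [norm_sub_rev] at h6
    constructor <;> linarith
  set S : Set (ι → ℝ) := (W : Set (ι → ℝ)) ∩ Metric.sphere 0 1 with hS
  have hScomp : IsCompact S :=
    (isCompact_sphere 0 1).inter_left W.closed_of_finiteDimensional
  have hmin : ∃ m : ℝ, 0 < m ∧ ∀ w ∈ S, ENNReal.ofReal m ≤ μ w := by
    rcases S.eq_empty_or_nonempty with he | hne
    · exact ⟨1, one_pos, fun w hw => by simp [he] at hw⟩
    obtain ⟨w₀, hw₀, hmin⟩ := hScomp.exists_isMinOn hne hcont.continuousOn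
    refine ⟨(μ w₀).toReal, ENNReal.toReal_pos ?_ (hfin _), fun w hw => ?_⟩
    · intro h0
      have h1 : w₀ ∈ Z ⊓ W := ⟨h0, hw₀.1⟩
      rw [hW.inf_eq_bot, Submodule.mem_bot] at h1
      have := hw₀.2
      simp [h1] at this
    · exact ENNReal.ofReal_le_of_le_toReal (hmin hw)
  obtain ⟨m, hm, hmS⟩ := hmin
  have hm0 : ENNReal.ofReal m ≠ 0 := by simpa using hm
  refine ⟨(ENNReal.ofReal m)⁻¹, ENNReal.inv_ne_top.2 hm0, fun v => ?_⟩
  have hv : v ∈ Z ⊔ W := by rw [hW.sup_eq_top]; trivial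
  obtain ⟨z, hz, w, hw, rfl⟩ := Submodule.mem_sup.1 hv
  refine ⟨z, hz, ?_⟩
  rw [add_sub_cancel_left]
  have hwv : μ w ≤ μ (z + w) := by
    calc μ w = μ (-z + (z + w)) := by rw [neg_add_cancel_left]
      _ ≤ μ (-z) + μ (z + w) := hadd _ _
      _ = μ (z + w) := by rw [hneg, show μ z = 0 from hz, zero_add]
  refine le_trans ?_ (mul_le_mul' le_rfl hwv)
  by_cases hw0 : w = 0
  · subst hw0
    simp [ENNReal.zero_rpow_of_pos hq]
  have hn : 0 < ‖w‖ := norm_pos_iff.2 hw0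
  have hwS : ‖w‖⁻¹ • w ∈ S := by
    refine ⟨W.smul_mem _ hw, ?_⟩
    rw [mem_sphere_zero_iff_norm, norm_smul, norm_inv, norm_norm, inv_mul_cancel₀ hn.ne']
  have h1 := hsmul ‖w‖ (‖w‖⁻¹ • w)
  rw [smul_smul, mul_inv_cancel₀ hn.ne', one_smul, enorm_norm] at h1
  rw [h1, mul_comm, mul_assoc]
  refine le_mul_of_one_le_right' ?_
  rw [← div_eq_mul_inv, ENNReal.le_div_iff_mul_le (Or.inl hm0) (Or.inl ENNReal.ofReal_ne_top),
    one_mul]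
  exact hmS _ hwS

end

section

/-! ### Whitney's inequality on a box -/

theorem diff_sub (r : ℕ) (h : Space d) (f g : Space d → ℝ) (x : Space d) :
    diff r h (fun x => f x - g x) x = diff r h f x - diff r h g x := by
  simp [diff, mul_sub]

section
variable {r : ℕ} (b : Module.Basis (Fin d) ℝ (Space d)) (a : Fin d → ℝ)

theorem exists_bound_tpoly :
    ∃ M : ℝ, 0 ≤ M ∧ ∀ c : (Fin d → Fin r) → ℝ, ∀ x ∈ box b a, |tpoly b c x| ≤ M * ‖c‖ := by
  have hc : Continuous fun x : Space d => ∑ α : Fin d → Fin r, |∏ i, b.repr x i ^ (α i : ℕ)| :=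
    continuous_finsetSum _ fun α _ =>
      (continuous_finsetProd _ fun i _ => (continuous_repr b i).pow _).abs
  obtain ⟨M, hM⟩ := (isCompact_coords b a fun i => a i + 1).exists_bound_of_continuousOn
    hc.continuousOn
  refine ⟨max M 0, le_max_right _ _, fun c x hx => ?_⟩
  have h1 := hM x fun i => ⟨(hx i).1, (hx i).2.le⟩
  rw [Real.norm_eq_abs, abs_of_nonneg (Finset.sum_nonneg fun _ _ => abs_nonneg _)] at h1
  calc |tpoly b c x|
      ≤ ∑ α : Fin d → Fin r, |c α * ∏ i, b.repr x i ^ (α i : ℕ)| :=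
        Finset.abs_sum_le_sum_abs _ _
    _ ≤ ∑ α : Fin d → Fin r, ‖c‖ * |∏ i, b.repr x i ^ (α i : ℕ)| := by
        refine Finset.sum_le_sum fun α _ => ?_
        rw [abs_mul]
        exact mul_le_mul_of_nonneg_right (norm_le_pi_norm c α) (abs_nonneg _)
    _ = (∑ α : Fin d → Fin r, |∏ i, b.repr x i ^ (α i : ℕ)|) * ‖c‖ := by
        rw [← Finset.mul_sum, mul_comm]
    _ ≤ max M 0 * ‖c‖ :=
        mul_le_mul_of_nonneg_right (h1.trans (le_max_left _ _)) (norm_nonneg _)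

/-- Polynomials with bounded coefficients are uniformly equicontinuous on a box. -/
theorem tpoly_uniform {ε : ℝ} (hε : 0 < ε) :
    ∃ N₀ : ℕ, ∀ N : ℕ, N₀ ≤ N → ∀ c : (Fin d → Fin r) → ℝ, ∀ x ∈ box b a, ∀ x' ∈ box b a,
      (∀ i, |b.repr x i - b.repr x' i| < 1 / N) → |tpoly b c x - tpoly b c x'| ≤ ε * ‖c‖ := by
  set m : (Fin d → ℝ) → (Fin d → Fin r) → ℝ := fun t α => ∏ i, t i ^ (α i : ℕ) with hm
  have hmc : Continuous m := by fun_prop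
  have hu := (isCompact_Icc (a := a) (b := fun i => a i + 1)).uniformContinuousOn_of_continuous
    hmc.continuousOn
  set n : ℝ := ((Fintype.card (Fin d → Fin r) : ℕ) : ℝ) with hn
  obtain ⟨δ, hδ, hu⟩ := Metric.uniformContinuousOn_iff.1 hu (ε / (n + 1)) (by positivity)
  obtain ⟨N₀, hN₀⟩ := exists_nat_one_div_lt hδ
  refine ⟨N₀ + 1, fun N hN c x hx x' hx' h => ?_⟩
  have hN' : (1 : ℝ) / N ≤ 1 / (N₀ + 1) :=
    one_div_le_one_div_of_le (by positivity) (by exact_mod_cast hN)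
  have h1 := hu (fun i => b.repr x i) ⟨fun i => (hx i).1, fun i => (hx i).2.le⟩
    (fun i => b.repr x' i) ⟨fun i => (hx' i).1, fun i => (hx' i).2.le⟩ (by
      rw [dist_pi_lt_iff hδ]
      intro i
      rw [Real.dist_eq]
      exact lt_of_lt_of_le (h i) (hN'.trans hN₀.le))
  rw [dist_eq_norm] at h1
  have h2 : tpoly b c x - tpoly b c x' = ∑ α, c α * (m (fun i => b.repr x i)
      - m (fun i => b.repr x' i)) α := by
    simp only [tpoly, hm, Pi.sub_apply, mul_sub, Finset.sum_sub_distrib]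
  rw [h2]
  calc _ ≤ ∑ α, |c α * (m (fun i => b.repr x i) - m (fun i => b.repr x' i)) α| :=
        Finset.abs_sum_le_sum_abs _ _
    _ ≤ ∑ _α : Fin d → Fin r, ‖c‖ * (ε / (n + 1)) := by
        refine Finset.sum_le_sum fun α _ => ?_
        rw [abs_mul]
        exact mul_le_mul (norm_le_pi_norm c α) ((norm_le_pi_norm _ α).trans h1.le)
          (abs_nonneg _) (norm_nonneg _)
    _ = n / (n + 1) * (ε * ‖c‖) := by
        rw [Finset.sum_const, Finset.card_univ, nsmul_eq_mul, ← hn]; ring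
    _ ≤ 1 * (ε * ‖c‖) := by
        refine mul_le_mul_of_nonneg_right ?_ (by positivity)
        rw [div_le_one (by positivity)]
        linarith
    _ = ε * ‖c‖ := one_mul _

theorem isOpen_openBox : IsOpen {x : Space d | ∀ i, a i < b.repr x i ∧ b.repr x i < a i + 1} := by
  simp only [ofPred_forall, ofPred_and]
  exact isOpen_iInter_of_finite fun i =>
    (isOpen_lt continuous_const (continuous_repr b i)).inter
      (isOpen_lt (continuous_repr b i) continuous_const)

theorem openBox_subset_box :
    {x : Space d | ∀ i, a i < b.repr x i ∧ b.repr x i < a i + 1} ⊆ box b a :=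
  fun _ hx i => ⟨(hx i).1.le, (hx i).2⟩

theorem openBox_nonempty :
    {x : Space d | ∀ i, a i < b.repr x i ∧ b.repr x i < a i + 1}.Nonempty := by
  refine ⟨∑ i, (a i + 1 / 2) • b i, fun i => ?_⟩
  rw [repr_sum_smul]
  constructor <;> linarith

theorem fNorm_tpoly_le (S : Set (Space d)) (hS : S ⊆ box b a) :
    ∃ C : ℝ≥0∞, C ≠ ∞ ∧ ∀ c : (Fin d → Fin r) → ℝ,
      fNorm p S (tpoly b c) ≤ C * ‖c‖ₑ ^ fExp p := by
  obtain ⟨M, hM0, hM⟩ := exists_bound_tpoly (r := r) b a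
  refine ⟨ENNReal.ofReal M ^ fExp p * fNorm p (box b a) (fun _ => (1 : ℝ)),
    ENNReal.mul_ne_top (ENNReal.rpow_ne_top_of_nonneg (fExp_nonneg p) (by simp))
      (fNorm_one_lt_top (volume_cell_ne_top b a 1)).ne, fun c => ?_⟩
  refine (fNorm_mono hS _).trans
    ((fNorm_le_of_bound (measurableSet_box b a) (by positivity) (hM c)).trans (le_of_eq ?_))
  rw [ENNReal.ofReal_mul hM0, ENNReal.mul_rpow_of_nonneg _ _ (fExp_nonneg p), ofReal_norm]
  ring

/-- The size of a tensor product polynomial on a box controls its coefficients. Allowing other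
coefficients of the same function spares a proof that they are unique. -/
theorem exists_coeff_le (hp0 : 0 < p) :
    ∃ C : ℝ≥0∞, C ≠ ∞ ∧ ∀ c : (Fin d → Fin r) → ℝ, ∃ c' : (Fin d → Fin r) → ℝ,
      tpoly b c' = tpoly b c ∧ ‖c'‖ₑ ^ fExp p ≤ C * fNorm p (box b a) (tpoly b c) := by
  obtain ⟨C, hC, hbd⟩ := fNorm_tpoly_le (p := p) (r := r) b a (box b a) subset_rfl
  obtain ⟨C', hC', h⟩ := exists_kernel_approx (fExp_pos hp0)
    (fun c : (Fin d → Fin r) → ℝ => fNorm p (box b a) (tpoly b c))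
    (fun v w => by
      simp only [show tpoly b (v + w) = fun x => tpoly b v x + tpoly b w x from
        funext (tpoly_add b v w)]
      exact fNorm_add_le hp0 (adm_tpoly b v) (adm_tpoly b w))
    (fun s v => by
      simp only [show tpoly b (s • v) = fun x => s * tpoly b v x from funext (tpoly_smul b s v)]
      exact fNorm_const_mul _ _) hC hbd
  refine ⟨C', hC', fun c => ?_⟩
  obtain ⟨z, hz, hle⟩ := h c
  refine ⟨c - z, ?_, hle⟩
  have h0 : fNorm p {x : Space d | ∀ i, a i < b.repr x i ∧ b.repr x i < a i + 1} (tpoly b z) = 0 :=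
    le_antisymm ((fNorm_mono (openBox_subset_box b a) _).trans hz.le) zero_le
  have h1 := (linePoly_tpoly b z).eq_zero (isOpen_openBox b a) (openBox_nonempty b a)
    (eqOn_zero_of_fNorm_eq_zero hp0 (isOpen_openBox b a) (continuous_tpoly b z) h0)
  funext x
  rw [tpoly_sub, h1, sub_zero]

theorem gridPt_update (N : ℕ) (j : Fin d → ℕ) (i : Fin d) (l : ℕ) :
    gridPt b N (Function.update j i (j i + l)) = gridPt b N j + (l : ℝ) • ((1 / N : ℝ) • b i) := by
  apply b.repr.injective
  ext k
  rw [smul_smul, repr_add_smul, gridPt, gridPt, repr_sum_smul, repr_sum_smul]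
  by_cases hk : k = i
  · subst hk
    simp only [Function.update_self, if_true]
    push_cast
    ring
  · simp [hk]

end

/-- The final absorption: a finite error that is at most `R` plus small multiples of itself is
bounded in terms of `R`. -/
theorem le_of_absorb {X R m : ℝ≥0∞} (hX : X ≠ ∞) (h1 : X ≤ R + 8⁻¹ * m + 8⁻¹ * (m + X))
    (h2 : m ≤ X + 1) : X ≤ 2 * (R + 1) := by
  by_cases hR : R = ∞
  · simp [hR]
  have hm : m ≠ ∞ := ne_top_of_le_ne_top (by simp [hX]) h2
  lift X to NNReal using hX
  lift R to NNReal using hR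
  lift m to NNReal using hm
  have h8 : (8⁻¹ : ℝ≥0∞) = ((8⁻¹ : NNReal) : ℝ≥0∞) := by
    rw [ENNReal.coe_inv (by norm_num)]; rfl
  rw [h8] at h1
  norm_cast at h1 h2 ⊢
  rw [← NNReal.coe_le_coe] at h1 h2 ⊢
  push_cast at h1 h2 ⊢
  have := R.coe_nonneg
  linarith

/-- Whitney's inequality on a box, for differences along the edges and approximation by
polynomials of degree less than `r` in each coordinate. -/
theorem exists_tpoly_approx (hp0 : 0 < p) {r : ℕ} (hr : 1 ≤ r)
    (b : Module.Basis (Fin d) ℝ (Space d)) (a : Fin d → ℝ) :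
    ∃ C : ℝ≥0∞, C ≠ ∞ ∧ ∀ f : Space d → ℝ, Adm p f → SmallDiff r p (box b a) b f →
      fNorm p (box b a) f ≠ ∞ →
      ∃ c : (Fin d → Fin r) → ℝ, fNorm p (box b a) (fun x => f x - tpoly b c x) ≤ C := by
  set q := fExp p with hq
  have hq0 : 0 < q := fExp_pos hp0
  set K := box b a with hK
  obtain ⟨C₁, hC₁, hsel⟩ := exists_sampling hp0 r b a
  obtain ⟨D, hD, hcoef⟩ := exists_coeff_le (p := p) (r := r) b a hp0
  obtain ⟨M, hM, htp⟩ := fNorm_tpoly_le (p := p) (r := r) b a K subset_rfl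
  set V := fNorm p K (fun _ => (1 : ℝ)) with hV
  have hVt : V ≠ ∞ := (fNorm_one_lt_top (volume_cell_ne_top b a 1)).ne
  have hmulsmall : ∀ c : ℝ≥0∞, c ≠ ∞ → ∃ θ : ℝ≥0∞, 0 < θ ∧ θ ≠ ∞ ∧ c * θ ≤ 8⁻¹ := by
    intro c hc
    refine ⟨8⁻¹ / (c + 1), ENNReal.div_pos (by simp) (by simp [hc]),
      ENNReal.div_ne_top (by simp) (by simp), ?_⟩
    rw [← mul_div_assoc]
    refine ENNReal.div_le_of_le_mul ?_
    rw [mul_comm]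
    gcongr
    exact le_self_add
  -- the oscillation `θ` of `g` and the mesh of the grid are chosen so small that all the terms
  -- proportional to the error can be absorbed
  obtain ⟨θ, hθ0, hθt, hθ⟩ := hmulsmall C₁ hC₁
  obtain ⟨C₀, hC₀, δ, hδ, hfirst⟩ := first_diff_box (d := d) hp0 hr θ hθ0
  obtain ⟨η, hη0, hηt, hη⟩ := hmulsmall (V * D) (ENNReal.mul_ne_top hVt hD)
  set ε : ℝ := (η ^ q⁻¹).toReal with hε
  have hηqt : η ^ q⁻¹ ≠ ∞ := ENNReal.rpow_ne_top_of_nonneg (by positivity) hηt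
  have hε0 : 0 < ε := ENNReal.toReal_pos (by
    rw [Ne, ENNReal.rpow_eq_zero_iff]; simp [hη0.ne', hηt]) hηqt
  have hεη : ENNReal.ofReal ε ^ q = η := by
    rw [hε, ENNReal.ofReal_toReal hηqt, ← ENNReal.rpow_mul, inv_mul_cancel₀ hq0.ne',
      ENNReal.rpow_one]
  obtain ⟨N₀, hN₀⟩ := tpoly_uniform (r := r) b a hε0
  obtain ⟨N₁, hN₁⟩ := exists_nat_one_div_lt hδ
  set N : ℕ := max N₀ (N₁ + 1) with hN
  have hN1 : 1 ≤ N := le_trans (by omega) (le_max_right _ _)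
  have hNδ : (1 : ℝ) / N ≤ δ := by
    refine le_trans (one_div_le_one_div_of_le (by positivity) ?_) hN₁.le
    exact_mod_cast (le_max_right N₀ (N₁ + 1))
  obtain ⟨A, hA⟩ := hsel N hN1
  set E : ℝ := max A 0 * (2 ^ r + 1) ^ (d * N) with hE
  have hE0 : 0 ≤ E := by positivity
  set R : ℝ≥0∞ := C₁ * (C₀ + 1) + ENNReal.ofReal E ^ q * V with hR
  have hRt : R ≠ ∞ := ENNReal.add_ne_top.2 ⟨ENNReal.mul_ne_top hC₁ (by simp [hC₀]),
    ENNReal.mul_ne_top (ENNReal.rpow_ne_top_of_nonneg hq0.le (by simp)) hVt⟩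
  refine ⟨2 * (R + 1), ENNReal.mul_ne_top (by simp) (by simp [hRt]), fun f hf hsm hft => ?_⟩
  -- subtract a nearly best approximation
  set e : ℝ≥0∞ := ⨅ c : (Fin d → Fin r) → ℝ, fNorm p K (fun x => f x - tpoly b c x) with he
  have het : e ≠ ∞ := by
    refine ne_top_of_le_ne_top hft ((iInf_le _ 0).trans (le_of_eq ?_))
    congr 1
    funext x
    simp [tpoly]
  obtain ⟨c₀, hc₀⟩ := iInf_lt_iff.1 (ENNReal.lt_add_right het one_ne_zero)
  set g : Space d → ℝ := fun x => f x - tpoly b c₀ x with hg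
  have hga : Adm p g := hf.sub (adm_tpoly b c₀)
  have hgs : SmallDiff r p K b g := by
    intro i u T hT
    refine le_trans (le_of_eq ?_) (hsm i u T hT)
    congr 1
    funext x
    rw [hg, diff_sub, diff_tpoly b hr, sub_zero]
  set m := fNorm p K g with hm
  have hmt : m ≠ ∞ := ne_top_of_le_ne_top (ENNReal.add_ne_top.2 ⟨het, by simp⟩) hc₀.le
  obtain ⟨y, hy, hy1, hy2⟩ := hA g (C₀ + 1 + θ * m) (by simp)
    (ENNReal.add_ne_top.2 ⟨by simp [hC₀], ENNReal.mul_ne_top hθt hmt⟩) hga hgs fun t ht =>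
      (hfirst b a g hga hgs t fun i => (ht i).trans hNδ).trans (by gcongr; exact le_self_add)
  -- interpolate the sampled values by a polynomial
  obtain ⟨c₂, hc₂⟩ := exists_tpoly_interpolating (r := r) b hN1 y fun j => g (y + gridPt b N j)
  obtain ⟨c₁, hc₁, hc₁le⟩ := hcoef c₂
  rw [← hc₁] at hc₂ hc₁le
  have hgrid : ∀ j : Fin d → ℕ, (∀ k, j k < N) →
      |g (y + gridPt b N j) - tpoly b c₁ (y + gridPt b N j)| ≤ E := by
    intro j hj
    refine abs_le_of_grid_diff (N := N) (r := r) (le_max_right A 0)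
      (fun j => g (y + gridPt b N j) - tpoly b c₁ (y + gridPt b N j))
      (fun j hj => by rw [hc₂ j hj, sub_self]) (fun i j hj hjr => ?_) (d * N) j hj ?_
    · refine le_trans (le_of_eq ?_) ((hy2 i j hj hjr).trans (le_max_left _ _))
      congr 1
      have h1 := diff_sub r ((1 / N : ℝ) • b i) g (tpoly b c₁) (y + gridPt b N j)
      rw [diff_tpoly b hr, sub_zero] at h1
      rw [← h1, diff]
      refine Finset.sum_congr rfl fun l _ => ?_
      rw [gridPt_update, ← add_assoc]
    · calc ∑ k, j k ≤ ∑ _k : Fin d, N := Finset.sum_le_sum fun k _ => (hj k).le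
        _ = d * N := by simp
  set κ : Space d → Space d := fun x => y + gridPt b N (cellIdx b a N x) with hκ
  have hκm : Measurable κ := (measurable_gridPt_cellIdx b a N).const_add y
  have hKm : MeasurableSet K := measurableSet_box b a
  set X := fNorm p K (fun x => g x - tpoly b c₁ x) with hX
  have hXe : e ≤ X := by
    refine (iInf_le _ (c₀ + c₁)).trans (le_of_eq ?_)
    rw [hX]
    congr 1
    funext x
    rw [tpoly_add, hg]
    ring
  have hXt : X ≠ ∞ := by
    refine ne_top_of_le_ne_top (ENNReal.add_ne_top.2 ⟨hmt, ?_⟩)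
      (fNorm_sub_le hp0 hga (adm_tpoly b c₁))
    exact ne_top_of_le_ne_top (ENNReal.mul_ne_top hM
      (ENNReal.rpow_ne_top_of_nonneg hq0.le (by simp))) (htp c₁)
  have hT : fNorm p K (tpoly b c₁) ≤ m + X := by
    have := fNorm_sub_le (S := K) hp0 hga (hga.sub (adm_tpoly b c₁))
    simpa only [sub_sub_cancel] using this
  have h1 : fNorm p K (fun x => g (κ x) - tpoly b c₁ (κ x)) ≤ ENNReal.ofReal E ^ q * V :=
    fNorm_le_of_bound hKm hE0 fun x hx => hgrid _ (cellIdx_lt hN1 hx)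
  have h2 : fNorm p K (fun x => tpoly b c₁ (κ x) - tpoly b c₁ x) ≤ 8⁻¹ * (m + X) := by
    have h3 : fNorm p K (fun x => tpoly b c₁ (κ x) - tpoly b c₁ x)
        ≤ ENNReal.ofReal (ε * ‖c₁‖) ^ q * V :=
      fNorm_le_of_bound hKm (by positivity) fun x hx =>
        hN₀ N (le_max_left _ _) c₁ _ (add_gridPt_mem_box hN1 hy (cellIdx_lt hN1 hx)) x hx
          (abs_repr_sub_lt hN1 hx hy)
    rw [ENNReal.ofReal_mul hε0.le, ENNReal.mul_rpow_of_nonneg _ _ hq0.le, hεη, ofReal_norm] at h3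
    calc _ ≤ η * ‖c₁‖ₑ ^ q * V := h3
      _ ≤ η * (D * (m + X)) * V := by
          gcongr
          exact hc₁le.trans (mul_le_mul' le_rfl hT)
      _ = V * D * η * (m + X) := by ring
      _ ≤ 8⁻¹ * (m + X) := by gcongr
  have h4 : X ≤ C₁ * (C₀ + 1 + θ * m) + (ENNReal.ofReal E ^ q * V + 8⁻¹ * (m + X)) := by
    have e1 : (fun x => g x - tpoly b c₁ x) = fun x => (g x - g (κ x)) +
        ((g (κ x) - tpoly b c₁ (κ x)) + (tpoly b c₁ (κ x) - tpoly b c₁ x)) := by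
      funext x; ring
    have t1 := hga.sub (hga.comp hκm)
    have t2 := (hga.comp hκm).sub ((adm_tpoly b c₁).comp hκm)
    have t3 := ((adm_tpoly (p := p) b c₁).comp hκm).sub (adm_tpoly b c₁)
    calc X = fNorm p K _ := congrArg (fNorm p K) e1
      _ ≤ _ := fNorm_add_le hp0 t1 (t2.add t3)
      _ ≤ _ := add_le_add hy1 ((fNorm_add_le hp0 t2 t3).trans (add_le_add h1 h2))
  refine ⟨c₀ + c₁, ?_⟩
  have e2 : (fun x => f x - tpoly b (c₀ + c₁) x) = fun x => g x - tpoly b c₁ x := by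
    funext x
    rw [tpoly_add, hg]
    ring
  rw [e2]
  refine le_of_absorb (m := m) hXt (h4.trans ?_) (hc₀.le.trans (by gcongr))
  calc C₁ * (C₀ + 1 + θ * m) + (ENNReal.ofReal E ^ q * V + 8⁻¹ * (m + X))
      = R + C₁ * θ * m + 8⁻¹ * (m + X) := by rw [hR]; ring
    _ ≤ R + 8⁻¹ * m + 8⁻¹ * (m + X) := by gcongr

end

section

open Polynomial

/-! ### Approximation from the directional polynomial space on a box -/

/-- On `K`, the differences of order `r` along the directions of `E` are at most `1`. -/
def DirDiff (r : ℕ) (p : ℝ≥0∞) (K E : Set (Space d)) (g : Space d → ℝ) : Prop :=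
  ∀ ξ ∈ E, ∀ (u : ℝ) (T : Set (Space d)),
    (∀ x ∈ T, ∀ j : ℕ, j ≤ r → x + (j : ℝ) • (u • ξ) ∈ K) → fNorm p T (diff r (u • ξ) g) ≤ 1

theorem DirDiff.mono {r : ℕ} {K K' E : Set (Space d)} {g : Space d → ℝ}
    (h : DirDiff r p K E g) (hK : K' ⊆ K) : DirDiff r p K' E g :=
  fun ξ hξ u T hT => h ξ hξ u T fun x hx j hj => hK (hT x hx j hj)

theorem DirDiff.sub_polySpace {r : ℕ} (hr : 1 ≤ r) {K E : Set (Space d)} {g Q : Space d → ℝ}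
    (h : DirDiff r p K E g) (hQ : Q ∈ polySpace r E) :
    DirDiff r p K E (fun x => g x - Q x) := by
  intro ξ hξ u T hT
  refine le_trans (le_of_eq ?_) (h ξ hξ u T hT)
  congr 1
  funext x
  obtain ⟨P, hP, hPQ⟩ := hQ.2 x ξ hξ
  rw [diff_sub, diff_eq_zero_of_degree_lt hr hP hPQ, sub_zero]

theorem fNorm_diff_le (hp0 : 0 < p) {f : Space d → ℝ} (hf : Adm p f) {S T : Set (Space d)}
    (r : ℕ) (h : Space d) (hST : ∀ x ∈ S, ∀ j : ℕ, j ≤ r → x + (j : ℝ) • h ∈ T) :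
    fNorm p S (diff r h f) ≤ polyBound p ((X - 1) ^ r) * fNorm p T f := by
  rw [← shiftPoly_X_sub_one_pow]
  refine fNorm_shiftPoly_le hp0 hf h _ fun x hx j hj => hST x hx j (hj.trans ?_)
  rw [← C_1, natDegree_pow, natDegree_X_sub_C, mul_one]

theorem continuous_diff {f : Space d → ℝ} (hf : Continuous f) (r : ℕ) (h : Space d) :
    Continuous (diff r h f) := by
  unfold diff
  fun_prop

/-- Whitney's inequality on a box whose edges have directions in `E`. Approximation by tensor
product polynomials is enough: the differences along the other directions of `E` control, by finite
dimensionality, the distance of such a polynomial to the directional polynomial space. -/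
theorem exists_polySpace_approx (hp0 : 0 < p) {r : ℕ} (hr : 1 ≤ r) {E : Set (Space d)}
    (hE : E ⊆ Metric.sphere 0 1) (hfin : E.Finite) (b : Module.Basis (Fin d) ℝ (Space d))
    (hb : ∀ i, ∃ s : ℝ, ∃ ξ ∈ E, b i = s • ξ) (a : Fin d → ℝ) :
    ∃ C : ℝ≥0∞, C ≠ ∞ ∧ ∀ f : Space d → ℝ, Adm p f → DirDiff r p (box b a) E f →
      fNorm p (box b a) f ≠ ∞ →
      ∃ Q ∈ polySpace r E, fNorm p (box b a) (fun x => f x - Q x) ≤ C := by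
  set q := fExp p with hq
  have hq0 : 0 < q := fExp_pos hp0
  set K := box b a with hK
  obtain ⟨C₁, hC₁, happ⟩ := exists_tpoly_approx hp0 hr b a
  obtain ⟨M, hM, htp⟩ := fNorm_tpoly_le (p := p) (r := r) b a K subset_rfl
  -- a small ball and a step `u` such that the differences on the ball only involve `K`
  obtain ⟨x₀, hx₀⟩ := openBox_nonempty b a
  obtain ⟨ε, hε, hball⟩ := Metric.isOpen_iff.1 (isOpen_openBox b a) x₀ hx₀
  set U := Metric.ball x₀ (ε / 2) with hU
  set u : ℝ := ε / (2 * (r + 1)) with hu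
  have hu0 : 0 < u := by positivity
  have hUK : ∀ ξ ∈ E, ∀ x ∈ U, ∀ j : ℕ, j ≤ r → x + (j : ℝ) • (u • ξ) ∈ K := by
    intro ξ hξ x hx j hj
    refine openBox_subset_box b a (hball ?_)
    rw [Metric.mem_ball, dist_eq_norm] at hx ⊢
    have h1 : ‖(j : ℝ) • (u • ξ)‖ ≤ ε / 2 := by
      rw [norm_smul, norm_smul, mem_sphere_zero_iff_norm.1 (hE hξ), mul_one, Real.norm_eq_abs,
        Real.norm_eq_abs, abs_of_pos hu0, Nat.abs_cast, hu]
      have : (j : ℝ) ≤ r + 1 := by exact_mod_cast hj.trans (Nat.le_succ r)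
      rw [mul_div_assoc', div_le_div_iff₀ (by positivity) (by positivity)]
      nlinarith
    calc ‖x + (j : ℝ) • (u • ξ) - x₀‖ = ‖(x - x₀) + (j : ℝ) • (u • ξ)‖ := by congr 1; abel
      _ ≤ ‖x - x₀‖ + ‖(j : ℝ) • (u • ξ)‖ := norm_add_le _ _
      _ < ε := by linarith
  set B := polyBound p ((X - 1 : ℝ[X]) ^ r) with hB
  have hBt : B ≠ ∞ := (polyBound_lt_top p _).ne
  have hdiff : ∀ ξ ∈ E, ∀ f : Space d → ℝ, Adm p f →
      fNorm p U (diff r (u • ξ) f) ≤ B * fNorm p K f :=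
    fun ξ hξ f hf => fNorm_diff_le hp0 hf r _ (hUK ξ hξ)
  set F := hfin.toFinset with hF
  have hFE : ∀ {ξ}, ξ ∈ F ↔ ξ ∈ E := hfin.mem_toFinset
  set μ : ((Fin d → Fin r) → ℝ) → ℝ≥0∞ := fun c => ∑ ξ ∈ F, fNorm p U (diff r (u • ξ) (tpoly b c))
    with hμ
  obtain ⟨C₂, hC₂, hker⟩ := exists_kernel_approx hq0 μ
    (fun v w => by
      simp only [hμ, ← Finset.sum_add_distrib]
      refine Finset.sum_le_sum fun ξ _ => ?_
      refine le_trans (le_of_eq ?_)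
        (fNorm_add_le hp0 ((adm_tpoly b v).diff r (u • ξ)) ((adm_tpoly b w).diff r (u • ξ)))
      congr 1
      funext x
      simp only [diff, tpoly_add, mul_add, Finset.sum_add_distrib])
    (fun s v => by
      simp only [hμ, Finset.mul_sum]
      refine Finset.sum_congr rfl fun ξ _ => ?_
      rw [← fNorm_const_mul]
      congr 1
      funext x
      simp only [diff, tpoly_smul, Finset.mul_sum]
      exact Finset.sum_congr rfl fun j _ => by ring)
    (C := F.card * (B * M)) (ENNReal.mul_ne_top (by simp) (ENNReal.mul_ne_top hBt hM))
    (fun v => by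
      refine (Finset.sum_le_card_nsmul F _ (B * (M * ‖v‖ₑ ^ q)) fun ξ hξ => ?_).trans
        (le_of_eq ?_)
      · exact (hdiff ξ (hFE.1 hξ) _ (adm_tpoly b v)).trans (mul_le_mul' le_rfl (htp v))
      · rw [nsmul_eq_mul]; ring)
  refine ⟨C₁ + M * (C₂ * (F.card * (1 + B * C₁))), by finiteness, fun f hf hdir hft => ?_⟩
  obtain ⟨c, hc⟩ := happ f hf (by
    intro i v T hT
    obtain ⟨s, ξ, hξ, hbi⟩ := hb i
    rw [hbi, smul_smul]
    refine hdir ξ hξ (v * s) T fun x hx j hj => ?_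
    have := hT x hx j hj
    rwa [hbi, smul_smul v] at this) hft
  obtain ⟨z, hz, hcz⟩ := hker c
  refine ⟨tpoly b z, ⟨continuous_tpoly b z, fun x ξ hξ =>
    ⟨tpolyLine b z x ξ, ?_, tpoly_line b z x ξ⟩⟩, ?_⟩
  · have h1 : fNorm p U (diff r (u • ξ) (tpoly b z)) = 0 :=
      (Finset.sum_eq_zero_iff.1 hz) ξ (hFE.2 hξ)
    have h2 := ((linePoly_tpoly b z).diff r (u • ξ)).eq_zero Metric.isOpen_ball
      ⟨x₀, Metric.mem_ball_self (by positivity)⟩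
      (eqOn_zero_of_fNorm_eq_zero hp0 Metric.isOpen_ball
        (continuous_diff (continuous_tpoly b z) r _) h1)
    exact degree_lt_of_diff_eq_zero (tpoly_line b z x ξ) hu0.ne' h2
  · have hμc : μ c ≤ F.card * (1 + B * C₁) := by
      refine (Finset.sum_le_card_nsmul F _ (1 + B * C₁) fun ξ hξ => ?_).trans
        (le_of_eq (nsmul_eq_mul _ _))
      have hfc : Adm p fun x => f x - tpoly b c x := hf.sub (adm_tpoly b c)
      have e1 : diff r (u • ξ) (tpoly b c) = fun x => diff r (u • ξ) f x -
          diff r (u • ξ) (fun x => f x - tpoly b c x) x := by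
        funext x
        rw [diff_sub, sub_sub_cancel]
      rw [e1]
      refine (fNorm_sub_le hp0 (hf.diff r _) (hfc.diff r _)).trans (add_le_add ?_ ?_)
      · exact hdir ξ (hFE.1 hξ) u U (hUK ξ (hFE.1 hξ))
      · exact (hdiff ξ (hFE.1 hξ) _ hfc).trans (mul_le_mul' le_rfl hc)
    have e2 : (fun x => f x - tpoly b z x) = fun x => (f x - tpoly b c x) + tpoly b (c - z) x := by
      funext x
      rw [tpoly_sub]
      ring
    rw [e2]
    refine (fNorm_add_le hp0 (hf.sub (adm_tpoly b c)) (adm_tpoly b (c - z))).trans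
      (add_le_add hc ((htp _).trans ?_))
    gcongr
    exact hcz.trans (mul_le_mul' le_rfl hμc)

end

section

/-! ### Propagation of bounds along directions -/

/-- A bound on `K`, together with bounded differences on `G` along `E`, gives a bound on `S`. -/
def Controls (r : ℕ) (p : ℝ≥0∞) (G E K : Set (Space d)) (C₀ : ℝ≥0∞) (S : Set (Space d)) : Prop :=
  ∃ C : ℝ≥0∞, C ≠ ∞ ∧ ∀ g : Space d → ℝ, Adm p g → DirDiff r p G E g → fNorm p K g ≤ C₀ →
    fNorm p S g ≤ C

/-- A bound on `K` gives a bound on `U ∩ G` for some neighbourhood `U` of `x`. -/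
def ControlsAt (r : ℕ) (p : ℝ≥0∞) (G E K : Set (Space d)) (C₀ : ℝ≥0∞) (x : Space d) : Prop :=
  ∃ U ∈ 𝓝 x, Controls r p G E K C₀ (U ∩ G)

variable {r : ℕ} {G E K S T : Set (Space d)} {C₀ : ℝ≥0∞}

theorem Controls.mono (h : Controls r p G E K C₀ S) (hTS : T ⊆ S) : Controls r p G E K C₀ T := by
  obtain ⟨C, hC, h⟩ := h
  exact ⟨C, hC, fun g hg hd hK => (fNorm_mono hTS g).trans (h g hg hd hK)⟩

theorem Controls.union (hp0 : 0 < p) (h : Controls r p G E K C₀ S)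
    (h' : Controls r p G E K C₀ T) : Controls r p G E K C₀ (S ∪ T) := by
  obtain ⟨C, hC, h⟩ := h
  obtain ⟨C', hC', h'⟩ := h'
  exact ⟨C + C', by finiteness, fun g hg hd hK =>
    (fNorm_union_le hp0 S T g).trans (add_le_add (h g hg hd hK) (h' g hg hd hK))⟩

theorem fNorm_empty (hp0 : 0 < p) (g : Space d → ℝ) : fNorm p ∅ g = 0 := by
  have h : normOn p ∅ g = 0 := by
    by_cases hp : p = ∞
    · subst hp; simp [normOn_top]
    · rw [normOn_of_ne_top hp]; simp
  rw [fNorm, h, ENNReal.zero_rpow_of_pos (fExp_pos hp0)]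

theorem isOpen_controlsAt : IsOpen {x | ControlsAt r p G E K C₀ x} := by
  rw [isOpen_iff_mem_nhds]
  rintro x ⟨U, hU, h⟩
  filter_upwards [eventually_mem_nhds_iff.2 hU] with y hy
  exact ⟨U, hy, h⟩

/-- If the points `x + h, …, x + r h` are interior and controlled, then so is `x`, which may lie on
the boundary: the difference of order `r` with step `h` expresses the values near `x`. -/
theorem ControlsAt.extend (hp0 : 0 < p) {x ξ : Space d} (hξ : ξ ∈ E) (u : ℝ)
    (h : ∀ j : ℕ, 1 ≤ j → j ≤ r → x + (j : ℝ) • (u • ξ) ∈ interior G ∧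
      ControlsAt r p G E K C₀ (x + (j : ℝ) • (u • ξ))) : ControlsAt r p G E K C₀ x := by
  have h' : ∀ j : Fin r, ControlsAt r p G E K C₀ (x + ((j + 1 : ℕ) : ℝ) • (u • ξ)) :=
    fun j => (h (j + 1) (by omega) j.2).2
  choose U hU C hC hbd using h'
  have hV : ∀ᶠ z in 𝓝 x, ∀ j : Fin r, z + ((j + 1 : ℕ) : ℝ) • (u • ξ) ∈ U j ∩ G := by
    rw [Filter.eventually_all]
    intro j
    have hc : Filter.Tendsto (fun z : Space d => z + ((j + 1 : ℕ) : ℝ) • (u • ξ)) (𝓝 x)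
        (𝓝 (x + ((j + 1 : ℕ) : ℝ) • (u • ξ))) := (continuous_add_const _).tendsto x
    exact hc (Filter.inter_mem (hU j) (mem_interior_iff_mem_nhds.1 (h (j + 1) (by omega) j.2).1))
  set V := {z | ∀ j : Fin r, z + ((j + 1 : ℕ) : ℝ) • (u • ξ) ∈ U j ∩ G} with hVdef
  refine ⟨V, hV, 1 + ∑ j : Fin r,
    ‖(-1 : ℝ) ^ (r + (j + 1)) * (r.choose (j + 1) : ℝ)‖ₑ ^ fExp p * C j, ?_, fun g hg hd hK => ?_⟩
  · refine ENNReal.add_ne_top.2 ⟨by simp, (ENNReal.sum_lt_top.2 fun j _ => ?_).ne⟩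
    exact (ENNReal.mul_ne_top (ENNReal.rpow_ne_top_of_nonneg (fExp_nonneg p) (by simp))
      (hC j)).lt_top
  set R : Space d → ℝ := fun z => ∑ j : Fin r, ((-1 : ℝ) ^ (r + (j + 1)) * (r.choose (j + 1) : ℝ))
    * g (z + ((j + 1 : ℕ) : ℝ) • (u • ξ)) with hR
  have e1 : g = fun z => (-1 : ℝ) ^ r * (diff r (u • ξ) g z - R z) := by
    funext z
    have h0 : diff r (u • ξ) g z = (-1) ^ r * g z + R z := by
      rw [diff, Finset.sum_range, Fin.sum_univ_succ]
      simp [hR]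
    rw [h0, add_sub_cancel_right, ← mul_assoc, ← mul_pow]
    simp
  have hRa : Adm p R := Adm.sum _ fun j _ => (hg.shift _).const_mul _
  rw [e1, fNorm_const_mul]
  have e2 : ‖(-1 : ℝ) ^ r‖ₑ ^ fExp p = 1 := by
    rw [enorm_pow, enorm_neg, enorm_one, one_pow, ENNReal.one_rpow]
  rw [e2, one_mul]
  refine (fNorm_sub_le hp0 (hg.diff r _) hRa).trans (add_le_add ?_ ?_)
  · refine hd ξ hξ u _ fun z hz j hj => ?_
    rcases j with _ | j
    · simpa using hz.2
    · exact (hz.1 ⟨j, hj⟩).2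
  · refine (fNorm_sum_le hp0 _ fun j _ => (hg.shift _).const_mul _).trans
      (Finset.sum_le_sum fun j _ => ?_)
    rw [fNorm_const_mul]
    gcongr
    exact (fNorm_shift_le _ (fun z hz => hz.1 j) g).trans (hbd j g hg hd hK)

/-- Control propagates along segments in the interior with direction in `E`. -/
theorem ControlsAt.segment (hp0 : 0 < p) (hr : 1 ≤ r) {y ξ : Space d} (hξ : ξ ∈ E) (c : ℝ)
    (hseg : ∀ s : ℝ, 0 ≤ s → s ≤ 1 → y + s • (c • ξ) ∈ interior G)
    (hy : ControlsAt r p G E K C₀ y) : ControlsAt r p G E K C₀ (y + c • ξ) := by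
  by_contra hcon
  set B : Set ℝ := Icc 0 1 ∩ {s | ¬ ControlsAt r p G E K C₀ (y + s • (c • ξ))} with hB
  have hBc : IsClosed B := by
    refine isClosed_Icc.inter ?_
    have : Continuous fun s : ℝ => y + s • (c • ξ) := by fun_prop
    exact (isOpen_controlsAt.preimage this).isClosed_compl
  have hBne : B.Nonempty := ⟨1, by simp, by simpa using hcon⟩
  have hBb : BddBelow B := ⟨0, fun s hs => hs.1.1⟩
  -- the first parameter that is not controlled can be reached from the ones before it
  have hs := hBc.csInf_mem hBne hBb
  set s := sInf B with hsdef
  have hs0 : 0 < s := by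
    rcases hs.1.1.eq_or_lt with h0 | h0
    · exfalso
      apply hs.2
      rw [← h0]
      simpa using hy
    · exact h0
  have hr' : (0 : ℝ) < r := by exact_mod_cast hr
  refine hs.2 (ControlsAt.extend hp0 hξ (-(s / r) * c) fun j hj hjr => ?_)
  have hj' : (1 : ℝ) ≤ j := by exact_mod_cast hj
  have hjr' : (j : ℝ) ≤ r := by exact_mod_cast hjr
  have e : y + s • (c • ξ) + (j : ℝ) • ((-(s / r) * c) • ξ) = y + (s - j * (s / r)) • (c • ξ) := by
    module
  rw [e]
  have h1 : j * (s / r) ≤ s := by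
    rw [mul_div_assoc', div_le_iff₀ hr']
    nlinarith
  have h2 : 0 < j * (s / r) := by positivity
  have h3 : s - j * (s / r) ≤ 1 := by linarith [hs.1.2]
  refine ⟨hseg _ (by linarith) h3, ?_⟩
  by_contra hn
  have := csInf_le hBb (show s - j * (s / r) ∈ B from ⟨⟨by linarith, h3⟩, hn⟩)
  linarith

/-- Control at one interior point propagates to the whole interior, since the directions of a basis
allow to join nearby points. -/
theorem controlsAt_interior (hp0 : 0 < p) (hr : 1 ≤ r) (hG : Convex ℝ G)
    (b : Module.Basis (Fin d) ℝ (Space d)) (hb : ∀ i, ∃ s : ℝ, ∃ ξ ∈ E, b i = s • ξ)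
    {x₀ : Space d} (hx₀ : x₀ ∈ interior G) (h : ControlsAt r p G E K C₀ x₀) :
    ∀ x ∈ interior G, ControlsAt r p G E K C₀ x := by
  refine hG.interior.isPreconnected.subset_of_closure_inter_subset isOpen_controlsAt
    ⟨x₀, hx₀, h⟩ ?_
  rintro x ⟨hxc, hx⟩
  obtain ⟨ε, hε, hball⟩ := Metric.isOpen_iff.1 isOpen_interior x hx
  set M : ℝ := ∑ i, ‖b i‖ with hM
  have hM0 : 0 ≤ M := Finset.sum_nonneg fun _ _ => norm_nonneg _
  set δ : ℝ := ε / (M + 1) with hδ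
  have hδ0 : 0 < δ := by positivity
  have hwin : ∀ z : Space d, (∀ i, |b.repr z i - b.repr x i| < δ) → z ∈ interior G := by
    intro z hz
    apply hball
    rw [Metric.mem_ball, dist_eq_norm, ← b.sum_repr (z - x)]
    calc ‖∑ i, b.repr (z - x) i • b i‖ ≤ ∑ i, ‖b.repr (z - x) i • b i‖ := norm_sum_le _ _
      _ ≤ ∑ i, δ * ‖b i‖ := by
          refine Finset.sum_le_sum fun i _ => ?_
          rw [norm_smul, Real.norm_eq_abs, map_sub, Finsupp.sub_apply]
          exact mul_le_mul_of_nonneg_right (hz i).le (norm_nonneg _)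
      _ = δ * M := by rw [← Finset.mul_sum]
      _ < δ * (M + 1) := by linarith [mul_add δ M 1]
      _ = ε := by rw [hδ, div_mul_cancel₀]; positivity
  have hW : IsOpen {z : Space d | ∀ i, |b.repr z i - b.repr x i| < δ} := by
    simp only [ofPred_forall]
    exact isOpen_iInter_of_finite fun i =>
      isOpen_lt ((continuous_repr b i).sub continuous_const).abs continuous_const
  obtain ⟨y, hyW, hy⟩ := mem_closure_iff.1 hxc _ hW (by simpa using fun _ => hδ0)
  set t : Fin d → ℝ := fun i => b.repr (x - y) i with ht
  have hty : ∀ i, b.repr x i = b.repr y i + t i := by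
    intro i
    simp [ht]
  have key : ∀ s : Finset (Fin d), ControlsAt r p G E K C₀ (y + ∑ i ∈ s, t i • b i) := by
    intro s
    induction s using Finset.induction_on with
    | empty =>
      rw [Finset.sum_empty, add_zero]
      exact hy
    | insert k s hk ih =>
      obtain ⟨ρ, ξ, hξ, hbk⟩ := hb k
      rw [Finset.sum_insert hk, add_comm (t k • b k), ← add_assoc, hbk, smul_smul]
      refine ih.segment hp0 hr hξ (t k * ρ) fun σ h0 h1 => hwin _ fun i => ?_
      rw [← smul_smul, ← hbk, smul_smul, repr_add_smul, hty i]
      have e : b.repr (y + ∑ i ∈ s, t i • b i) i = b.repr y i + if i ∈ s then t i else 0 := by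
        simp [Finsupp.single_apply, Finset.sum_ite_eq']
      rw [e]
      have h2 : |t i| < δ := by
        have := hyW i
        rw [hty i] at this
        rwa [sub_add_cancel_left, abs_neg] at this
      by_cases his : i ∈ s
      · have hik : i ≠ k := fun h => hk (h ▸ his)
        simpa [his, hik] using hδ0
      · by_cases hik : i = k
        · subst hik
          simp only [his, if_false, if_true, add_zero]
          have : b.repr y i + σ * t i - (b.repr y i + t i) = (σ - 1) * t i := by ring
          rw [this, abs_mul]
          refine lt_of_le_of_lt (mul_le_of_le_one_left (abs_nonneg _) ?_) h2
          rw [abs_le]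
          constructor <;> linarith
        · simpa [his, hik] using h2
  have hfinal := key Finset.univ
  rw [b.sum_repr, add_sub_cancel] at hfinal
  exact hfinal

/-- Control at one interior point of a convex body that is X-rayed by `E` gives control of the whole
body: each boundary point is reached from the interior by an illuminating direction. -/
theorem controls_of_xRays (hp0 : 0 < p) (hr : 1 ≤ r) (hG : IsConvexBody G) (hX : XRays E G)
    (b : Module.Basis (Fin d) ℝ (Space d)) (hb : ∀ i, ∃ s : ℝ, ∃ ξ ∈ E, b i = s • ξ)
    {x₀ : Space d} (hx₀ : x₀ ∈ interior G) (h : ControlsAt r p G E K C₀ x₀) :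
    Controls r p G E K C₀ G := by
  have hint := controlsAt_interior hp0 hr hG.convex b hb hx₀ h
  have hr' : (0 : ℝ) < r := by exact_mod_cast hr
  have hall : ∀ x ∈ G, ControlsAt r p G E K C₀ x := by
    intro x hx
    by_cases hxi : x ∈ interior G
    · exact hint x hxi
    have hfr : x ∈ frontier G := ⟨subset_closure hx, hxi⟩
    obtain ⟨e, he, t, ht, hte⟩ := hX x hfr
    obtain ⟨ξ, hξ, σ, hσ⟩ : ∃ ξ ∈ E, ∃ σ : ℝ, e = σ • ξ := by
      rcases he with he | he
      · exact ⟨e, he, 1, by simp⟩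
      · exact ⟨-e, he, -1, by simp⟩
    refine ControlsAt.extend hp0 hξ (t / r * σ) fun j hj hjr => ?_
    have hmem : x + (j : ℝ) • ((t / r * σ) • ξ) ∈ interior G := by
      have h1 := hG.convex.add_smul_sub_mem_interior hx hte (t := j / r)
        ⟨by positivity, (div_le_one hr').2 (by exact_mod_cast hjr)⟩
      convert h1 using 1
      rw [hσ]
      module
    exact ⟨hmem, hint _ hmem⟩
  have := hG.isCompact.induction_on (p := fun S => Controls r p G E K C₀ (S ∩ G))
    (by
      refine ⟨0, by simp, fun g _ _ _ => ?_⟩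
      rw [empty_inter, fNorm_empty hp0])
    (fun S T hST hT => hT.mono (inter_subset_inter_left _ hST))
    (fun S T hS hT => by
      rw [union_inter_distrib_right]
      exact hS.union hp0 hT)
    (fun x hx => by
      obtain ⟨U, hU, hc⟩ := hall x hx
      exact ⟨U, mem_nhdsWithin_of_mem_nhds hU, hc⟩)
  rwa [inter_self] at this

end

section

/-! ### From `L^p(G)` to everywhere defined measurable functions -/

theorem measurableSet_diffDomain {G : Set (Space d)} (hG : MeasurableSet G) (r : ℕ)
    (h : Space d) : MeasurableSet (diffDomain r h G) := by
  simp only [diffDomain, ofPred_forall]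
  exact MeasurableSet.iInter fun j => MeasurableSet.iInter fun _ =>
    hG.preimage (measurable_add_const _)

/-- A function whose modulus is at most `1` has differences at most `1`: the steps of length more
than the diameter of `G` do not occur. -/
theorem dirDiff_of_modulus_le (hp0 : 0 < p) {r : ℕ} (hr : 1 ≤ r) {G E : Set (Space d)}
    (hG : Bornology.IsBounded G) (hE : E ⊆ Metric.sphere 0 1) {f : Space d → ℝ}
    (h : modulus r p G E f ≤ 1) : DirDiff r p G E f := by
  intro ξ hξ u T hT
  rcases T.eq_empty_or_nonempty with rfl | ⟨x, hx⟩
  · rw [fNorm_empty hp0]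
    exact zero_le_one
  have hu : |u| ≤ Metric.diam G := by
    have h0 := hT x hx 0 (Nat.zero_le _)
    have h1 := hT x hx 1 hr
    have := Metric.dist_le_diam_of_mem hG h1 h0
    rw [dist_eq_norm] at this
    simpa [norm_smul, mem_sphere_zero_iff_norm.1 (hE hξ)] using this
  refine (fNorm_mono (T := diffDomain r (u • ξ) G) hT _).trans ?_
  rw [fNorm, ← ENNReal.one_rpow (fExp p)]
  refine ENNReal.rpow_le_rpow (le_trans ?_ h) (fExp_nonneg p)
  refine le_trans ?_ (le_iSup₂_of_le (f := fun ξ (_ : ξ ∈ E) =>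
    modulusAlong r p G ξ f (Metric.diam G)) ξ hξ le_rfl)
  exact le_iSup₂_of_le (f := fun (u : ℝ) (_ : |u| ≤ Metric.diam G) =>
    normOn p (diffDomain r (u • ξ) G) (diff r (u • ξ) f)) u hu le_rfl

/-- Every function in `L^p(G)` may be replaced by an admissible one. -/
theorem exists_adm_representative {r : ℕ} {G E : Set (Space d)}
    (hG : IsCompact G) {f : Space d → ℝ} (hf : MemLpOn p G f) :
    ∃ F : Space d → ℝ, Adm p F ∧ fNorm p G F ≠ ∞ ∧ modulus r p G E F = modulus r p G E f ∧
      ∀ Q : Space d → ℝ, normOn p G (fun x => f x - Q x) = normOn p G (fun x => F x - Q x) := by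
  by_cases hp : p = ∞
  · subst hp
    refine ⟨f, fun h => absurd rfl h, ?_, rfl, fun _ => rfl⟩
    have hc := hf.2 rfl
    rw [hG.isClosed.closure_eq] at hc
    obtain ⟨M, hM⟩ := hG.exists_bound_of_continuousOn hc
    rw [fNorm_top]
    refine ne_top_of_le_ne_top (b := ENNReal.ofReal M) (by simp) (iSup₂_le fun x hx => ?_)
    rw [← ofReal_norm]
    exact ENNReal.ofReal_le_ofReal (hM x hx)
  · have hfp := hf.1 hp
    have hGm : MeasurableSet G := hG.isClosed.measurableSet
    obtain ⟨F, hFm, hFf⟩ := hfp.1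
    have hFf' : ∀ᵐ x ∂(volume : Measure (Space d)), x ∈ G → f x = F x :=
      (ae_restrict_iff' hGm).1 hFf
    refine ⟨F, fun _ => hFm.measurable, ?_, ?_, fun Q => ?_⟩
    · refine (ENNReal.rpow_lt_top_of_nonneg (fExp_nonneg p) ?_).ne
      rw [normOn_of_ne_top hp, ← eLpNorm_congr_ae hFf]
      exact hfp.2.ne
    · simp only [modulus, modulusAlong]
      refine iSup_congr fun ξ => iSup_congr fun _ => iSup_congr fun u => iSup_congr fun _ => ?_
      rw [normOn_of_ne_top hp, normOn_of_ne_top hp]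
      refine eLpNorm_congr_ae ?_
      rw [Filter.EventuallyEq, ae_restrict_iff' (measurableSet_diffDomain hGm r _)]
      have h1 : ∀ᵐ x ∂(volume : Measure (Space d)), ∀ j : ℕ,
          x + (j : ℝ) • (u • ξ) ∈ G → f (x + (j : ℝ) • (u • ξ)) = F (x + (j : ℝ) • (u • ξ)) :=
        ae_all_iff.2 fun j => (measurePreserving_add_right (volume : Measure (Space d))
          ((j : ℝ) • (u • ξ))).quasiMeasurePreserving.ae hFf'
      filter_upwards [h1] with x hx hxD
      refine Finset.sum_congr rfl fun j hj => ?_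
      rw [hx j (hxD j (Nat.lt_succ_iff.1 (Finset.mem_range.1 hj)))]
    · rw [normOn_of_ne_top hp, normOn_of_ne_top hp]
      refine eLpNorm_congr_ae ?_
      filter_upwards [hFf] with x hx
      rw [hx]

/-! ### Illumination -/

/-- Directions that X-ray `G` span the space: a linear functional vanishing on them would attain its
maximum over `G` at a boundary point that is not illuminated. -/
theorem span_eq_top_of_xRays {G E : Set (Space d)} (hG : IsConvexBody G) (hX : XRays E G) :
    Submodule.span ℝ E = ⊤ := by
  by_contra hne
  obtain ⟨x, hx⟩ : ∃ x, x ∉ Submodule.span ℝ E := by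
    by_contra! h
    exact hne (eq_top_iff.2 fun x _ => h x)
  obtain ⟨φ, hφx, hφ⟩ := Submodule.exists_dual_map_eq_bot_of_notMem hx inferInstance
  have hφE : ∀ e ∈ E ∪ -E, φ e = 0 := by
    have h0 : ∀ e ∈ E, φ e = 0 := by
      intro e he
      have : φ e ∈ (Submodule.span ℝ E).map φ :=
        Submodule.mem_map_of_mem (Submodule.subset_span he)
      rwa [hφ, Submodule.mem_bot] at this
    rintro e (he | he)
    · exact h0 e he
    · simpa using h0 (-e) he
  have hφc : Continuous φ := φ.continuous_of_finiteDimensional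
  obtain ⟨z, hz, hmax⟩ := hG.isCompact.exists_isMaxOn
    (hG.interior_nonempty.mono interior_subset) hφc.continuousOn
  -- moving in the direction `x` increases or decreases the functional, so that no interior point
  -- is a maximizer
  have hint : ∀ y ∈ interior G, φ y ≠ φ z := by
    intro y hy hyz
    have hc : Filter.Tendsto (fun s : ℝ => y + (s * φ x) • x) (𝓝 0) (𝓝 y) := by
      have : Continuous fun s : ℝ => y + (s * φ x) • x := by fun_prop
      simpa using this.tendsto 0
    have hev := hc (isOpen_interior.mem_nhds hy)
    obtain ⟨ε, hε, hball⟩ := Metric.mem_nhds_iff.1 hev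
    have h1 : ε / 2 ∈ Metric.ball (0 : ℝ) ε := by
      rw [Metric.mem_ball, Real.dist_eq, sub_zero, abs_of_pos (by positivity)]
      linarith
    have h2 := hmax (interior_subset (hball h1))
    simp only [mem_ofPred_eq, map_add, map_smul, smul_eq_mul, hyz] at h2
    have h3 : 0 < φ x * φ x := mul_self_pos.2 hφx
    nlinarith
  have hzf : z ∈ frontier G := ⟨subset_closure hz, fun h => hint z h rfl⟩
  obtain ⟨e, he, t, _, hte⟩ := hX z hzf
  exact hint _ hte (by simp [hφE e he])

/-- A convex body is X-rayed by finitely many directions: each boundary point is illuminated by the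
direction to a fixed interior point, this direction works nearby, and the boundary is compact. -/
theorem exists_finset_xRays {G : Set (Space d)} (hG : IsConvexBody G) :
    ∃ E : Finset (Space d), (E : Set (Space d)) ⊆ Metric.sphere 0 1 ∧
      XRays (E : Set (Space d)) G := by
  classical
  obtain ⟨c, hc⟩ := hG.interior_nonempty
  have hcomp : IsCompact (frontier G) :=
    hG.isCompact.of_isClosed_subset isClosed_frontier hG.isCompact.isClosed.frontier_subset
  have hne : ∀ x ∈ frontier G, 0 < ‖c - x‖ := by
    intro x hx
    rw [norm_pos_iff, sub_ne_zero]
    rintro rfl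
    exact hx.2 hc
  obtain ⟨s, hs, hcov⟩ := hcomp.elim_nhds_subcover
    (fun x => {y | y + ‖c - x‖ • (‖c - x‖⁻¹ • (c - x)) ∈ interior G}) fun x hx => by
      have h1 : x + ‖c - x‖ • (‖c - x‖⁻¹ • (c - x)) = c := by
        rw [smul_smul, mul_inv_cancel₀ (hne x hx).ne', one_smul, add_sub_cancel]
      refine (isOpen_interior.preimage (continuous_add_const _)).mem_nhds ?_
      rw [mem_preimage, h1]
      exact hc
  refine ⟨s.image fun x => ‖c - x‖⁻¹ • (c - x), fun e he => ?_, fun y hy => ?_⟩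
  · obtain ⟨x, hx, rfl⟩ := Finset.mem_image.1 (Finset.mem_coe.1 he)
    rw [mem_sphere_zero_iff_norm, norm_smul, norm_inv, norm_norm,
      inv_mul_cancel₀ (hne x (hs x hx)).ne']
  · obtain ⟨x, hx, hyx⟩ := mem_iUnion₂.1 (hcov hy)
    exact ⟨_, Or.inl (Finset.mem_coe.2 (Finset.mem_image_of_mem _ hx)), ‖c - x‖,
      norm_nonneg _, hyx⟩

theorem exists_basis_mem {E : Set (Space d)} (hE : Submodule.span ℝ E = ⊤) :
    ∃ b : Module.Basis (Fin d) ℝ (Space d), ∀ i, b i ∈ E := by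
  obtain ⟨B, hBE, hspan, hli⟩ := exists_linearIndependent ℝ E
  have hB : ⊤ ≤ Submodule.span ℝ (range ((↑) : B → Space d)) := by
    rw [Subtype.range_coe, hspan, hE]
  set β := Module.Basis.mk hli hB with hβ
  refine ⟨β.reindex (β.indexEquiv (EuclideanSpace.basisFun (Fin d) ℝ).toBasis), fun i => ?_⟩
  rw [Module.Basis.reindex_apply, hβ, Module.Basis.mk_apply]
  exact hBE (Subtype.coe_prop _)

/-! ### The Whitney constant of an X-rayed body -/

theorem whitneyConst_lt_top (hp0 : 0 < p) {r : ℕ} (hr : 1 ≤ r) {G E : Set (Space d)}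
    (hG : IsConvexBody G) (hE : E ⊆ Metric.sphere 0 1) (hfin : E.Finite) (hX : XRays E G) :
    whitneyConst r p G E < ∞ := by
  obtain ⟨β, hβ⟩ := exists_basis_mem (span_eq_top_of_xRays hG hX)
  -- a box inside `G` with edges parallel to directions of `E`
  obtain ⟨x₀, hx₀⟩ := hG.interior_nonempty
  obtain ⟨ε, hε, hball⟩ := Metric.isOpen_iff.1 isOpen_interior x₀ hx₀
  set ρ : ℝ := ε / (d + 1) with hρ
  have hρ0 : 0 < ρ := by positivity
  set b := β.isUnitSMul (w := fun _ => ρ) (fun _ => hρ0.ne'.isUnit) with hbdef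
  have hbi : ∀ i, b i = ρ • β i := fun i => Module.Basis.isUnitSMul_apply _ i
  have hb : ∀ i, ∃ s : ℝ, ∃ ξ ∈ E, b i = s • ξ := fun i => ⟨ρ, β i, hβ i, hbi i⟩
  set a : Fin d → ℝ := fun i => b.repr x₀ i with ha
  have hKint : box b a ⊆ interior G := by
    intro x hx
    apply hball
    rw [Metric.mem_ball, dist_eq_norm, ← b.sum_repr (x - x₀)]
    calc ‖∑ i, b.repr (x - x₀) i • b i‖ ≤ ∑ i, ‖b.repr (x - x₀) i • b i‖ := norm_sum_le _ _
      _ ≤ ∑ _i : Fin d, ρ := by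
          refine Finset.sum_le_sum fun i _ => ?_
          have h1 := hx i
          rw [hbi, norm_smul, norm_smul, mem_sphere_zero_iff_norm.1 (hE (hβ i)), mul_one,
            Real.norm_eq_abs, Real.norm_eq_abs, abs_of_pos hρ0, map_sub, Finsupp.sub_apply]
          refine mul_le_of_le_one_left hρ0.le ?_
          rw [abs_le]
          constructor <;> linarith
      _ = d * ρ := by simp
      _ < (d + 1) * ρ := by linarith [add_mul (d : ℝ) 1 ρ]
      _ = ε := by rw [hρ, mul_div_cancel₀]; positivity
  have hKG : box b a ⊆ G := hKint.trans interior_subset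
  obtain ⟨C₀, hC₀, happ⟩ := exists_polySpace_approx hp0 hr hE hfin b hb a
  obtain ⟨x₁, hx₁⟩ := openBox_nonempty b a
  obtain ⟨C, hC, hctrl⟩ := controls_of_xRays (E := E) (K := box b a) (C₀ := C₀) hp0 hr hG hX b hb
    (hKint (openBox_subset_box b a hx₁))
    ⟨_, (isOpen_openBox b a).mem_nhds hx₁, C₀, hC₀, fun g _ _ hK =>
      (fNorm_mono (inter_subset_left.trans (openBox_subset_box b a)) g).trans hK⟩
  have hq := fExp_pos hp0
  refine lt_of_le_of_lt (iSup_le fun f => iSup₂_le fun hf hω => ?_)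
    (ENNReal.rpow_lt_top_of_nonneg (y := (fExp p)⁻¹) (by positivity) hC)
  obtain ⟨F, hFa, hFt, hFω, hFQ⟩ := exists_adm_representative (r := r) (E := E) hG.isCompact hf
  rw [← hFω] at hω
  have hFd := dirDiff_of_modulus_le hp0 hr hG.isCompact.isBounded hE hω
  obtain ⟨Q, hQ, hFQK⟩ := happ F hFa (hFd.mono hKG)
    (ne_top_of_le_ne_top hFt (fNorm_mono hKG F))
  refine (iInf₂_le Q hQ).trans ?_
  rw [hFQ Q, ENNReal.le_rpow_inv_iff hq]
  exact hctrl _ (hFa.sub (Adm.of_continuous hQ.1)) (hFd.sub_polySpace hr hQ) hFQK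

end

end DirWhitney

theorem mainTheorem1 (d : ℕ) (hd : 1 ≤ d) (G : Set (DirWhitney.Space d))
    (hG : DirWhitney.IsConvexBody G) :
    (∀ E : Set (DirWhitney.Space d), E ⊆ Metric.sphere 0 1 → E.Finite →
      DirWhitney.XRays E G →
      ∀ r : ℕ, 1 ≤ r → ∀ p : ℝ≥0∞, 0 < p → DirWhitney.whitneyConst r p G E < ∞) ∧
    DirWhitney.xrayNumber G < ⊤ ∧
    DirWhitney.whitneyNumber G ≤ DirWhitney.xrayNumber G := by
  obtain ⟨E₀, hE₀, hX₀⟩ := DirWhitney.exists_finset_xRays hG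
  refine ⟨fun E hE hfin hX r hr p hp => DirWhitney.whitneyConst_lt_top hp hr hG hE hfin hX,
    lt_of_le_of_lt (sInf_le ⟨E₀, hE₀, rfl, hX₀⟩) (by simp), ?_⟩
  refine le_sInf ?_
  rintro n ⟨E, hE, hn, hX⟩
  exact sInf_le ⟨E, hE, hn, DirWhitney.span_eq_top_of_xRays hG hX, fun r hr p hp =>
    DirWhitney.whitneyConst_lt_top hp hr hG hE E.finite_toSet hX⟩
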